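/- Let $K\ge 2$, let $\Delta_{K-1}=\{\theta\in\mathbb R^K:\theta_k\ge 0,\ \sum_k\theta_k=1\}$, and let $\mathrm{Dir}_\alpha$ be the Dirichlet distribution on $\Delta_{K-1}$ with parameter $\alpha\in(0,\infty)^K$, that is, the law of $\theta=(y_1,\dots,y_{K-1},1-\sum_{i<K}y_i)$ where $y$ has Lebesgue density $\frac{\Gamma(\sum_k\alpha_k)}{\prod_k\Gamma(\alpha_k)}\prod_{k=1}^K\theta_k^{\alpha_k-1}$ on $\{y\in\mathbb R^{K-1}: y_i\ge 0,\ \sum_i y_i\le 1\}$. Let $p=(p_1,\dots,p_V)$ be a probability vector (word frequencies), let $\phi_1,\dots,\phi_K$ be probability vectors on $\{1,\dots,V\}$ (topics), and let $$H(\theta)=\sum_{v=1}^V p_v\log\Bigl(\sum_{k=1}^K\theta_k\phi_k(v)\Bigr)$$ be the LDA log-likelihood, with values in $\mathbb R\cup\{-\infty\}$ on $\Delta_{K-1}$ and $0\log 0=0$. Suppose that $H$ attains its maximum over $\Delta_{K-1}$ at exactly one point $\theta^*$, that $H(\theta^*)$ is finite, and that $\theta^*_k>0$ for all $k$. Put $$\mathrm{KL}(\theta^*|\theta)=\sum_{k=1}^K\theta^*_k\log\frac{\theta^*_k}{\theta_k},\qquad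 \widehat H(\theta)=H(\theta^*)-\mathrm{KL}(\theta^*|\theta),$$ and, for real $n>0$ and $\theta\sim\mathrm{Dir}_\alpha$, let $$\rho_n=\frac{\mathrm{Cov}\bigl(e^{nH(\theta)},e^{n\widehat H(\theta)}\bigr)}{\sqrt{\mathrm{Var}\bigl(e^{nH(\theta)}\bigr)\,\mathrm{Var}\bigl(e^{n\widehat H(\theta)}\bigr)}}.$$ Let $Q=\nabla^2H(\theta^*)$ and $R=-\nabla^2_\theta\mathrm{KL}(\theta^*|\theta)\big|_{\theta=\theta^*}$ be the full $K\times K$ Hessians. Then, as $n\to\infty$ with $p$, $\phi$, $\alpha$ fixed, $$\rho_n^2\;\longrightarrow\;\frac{|\det Q|^{1/2}\,|\det R|^{1/2}}{\bigl|\det\bigl(\tfrac{Q+R}{2}\bigr)\bigr|}.$$ -/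

import Mathlib

open Filter Topology MeasureTheory ProbabilityTheory

noncomputable section

namespace LDA

/-- The projected simplex `{y ∈ ℝ^d : y_i ≥ 0, ∑ y_i ≤ 1}`; here `d = K - 1`. -/
def projSimplex (d : ℕ) : Set (Fin d → ℝ) :=
  {y | (∀ i, 0 ≤ y i) ∧ ∑ i, y i ≤ 1}

/-- The coordinate map `y ↦ (y_1, …, y_d, 1 - ∑ y_i)` from the projected simplex onto the
standard simplex of `ℝ^(d+1)`. -/
def simplexMap (d : ℕ) (y : Fin d → ℝ) : Fin (d + 1) → ℝ :=
  Fin.snoc (α := fun _ => ℝ) y (1 - ∑ i, y i)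

theorem measurable_simplexMap (d : ℕ) : Measurable (simplexMap d) := by
  refine measurable_pi_lambda _ fun i => ?_
  refine Fin.lastCases ?_ (fun j => ?_) i
  · simp only [simplexMap, Fin.snoc_last]
    fun_prop
  · simp only [simplexMap, Fin.snoc_castSucc]
    fun_prop

/-- The multivariate Beta function `∏ Γ(α_i) / Γ(∑ α_i)`. -/
def multiBeta {d : ℕ} (α : Fin (d + 1) → ℝ) : ℝ :=
  (∏ i, Real.Gamma (α i)) / Real.Gamma (∑ i, α i)

/-- The density `B(α)⁻¹ ∏_{i ≤ K} θ_i ^ (α_i - 1)` of the Dirichlet distribution at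
`θ = (y_1, …, y_d, 1 - ∑ y_i)`. -/
def dirichletDensity {d : ℕ} (α : Fin (d + 1) → ℝ) (y : Fin d → ℝ) : ℝ :=
  (multiBeta α)⁻¹ * ∏ i, simplexMap d y i ^ (α i - 1)

/-- The Dirichlet distribution with parameter `α`, as a measure on `ℝ^K`, `K = d + 1`: it has the
density `dirichletDensity α` with respect to Lebesgue measure in the coordinates `y`. It gives
no mass to points with a zero coordinate. -/
def dirichlet {d : ℕ} (α : Fin (d + 1) → ℝ) : Measure (Fin (d + 1) → ℝ) :=
  (((volume : Measure (Fin d → ℝ)).restrict (projSimplex d)).withDensity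
    fun y => ENNReal.ofReal (dirichletDensity α y)).map (simplexMap d)

/-- The Hessian matrix of `f : ℝ^K → ℝ` at `x`. -/
def hessian {K : ℕ} (f : (Fin K → ℝ) → ℝ) (x : Fin K → ℝ) : Matrix (Fin K) (Fin K) ℝ :=
  Matrix.of fun i j => fderiv ℝ (fderiv ℝ f) x (Pi.single i 1) (Pi.single j 1)

/-- The log-likelihood `H(θ) = ∑_v p_v log (∑_k θ_k φ_k(v))`, with word frequencies `p` and topic
vectors `φ_k`. This is the value of `H` at the points where the true `H` is finite. -/
def logLik {K V : ℕ} (p : Fin V → ℝ) (φ : Fin K → Fin V → ℝ) (θ : Fin K → ℝ) : ℝ :=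
  ∑ v, p v * Real.log (∑ k, θ k * φ k v)

/-- The points of the simplex at which `H` is finite: every word that occurs has positive
probability. At the other points of the simplex `H = -∞`. If all `φ_k(v)` are positive, this is
the whole simplex. -/
def finiteDomain {K V : ℕ} (p : Fin V → ℝ) (φ : Fin K → Fin V → ℝ) : Set (Fin K → ℝ) :=
  {θ | θ ∈ stdSimplex ℝ (Fin K) ∧ ∀ v, 0 < p v → 0 < ∑ k, θ k * φ k v}

/-- `θ'` is the unique maximizer over the simplex of `H`, read as a function with values in
`ℝ ∪ {-∞}`, and `H(θ')` is finite. -/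
def IsUniqueMaximizer {K V : ℕ} (p : Fin V → ℝ) (φ : Fin K → Fin V → ℝ) (θ' : Fin K → ℝ) : Prop :=
  θ' ∈ finiteDomain p φ ∧ ∀ θ ∈ finiteDomain p φ, θ ≠ θ' → logLik p φ θ < logLik p φ θ'

/-- The Kullback-Leibler divergence `KL(θ' | θ) = ∑_k θ'_k log (θ'_k / θ_k)`, at points `θ` with
positive coordinates. -/
def klDivergence {K : ℕ} (θ' θ : Fin K → ℝ) : ℝ :=
  ∑ k, θ' k * Real.log (θ' k / θ k)

/-- The exponent `Ĥ(θ) = H(θ') - KL(θ' | θ)` of the control variate. -/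
def controlExponent {K V : ℕ} (p : Fin V → ℝ) (φ : Fin K → Fin V → ℝ) (θ' θ : Fin K → ℝ) : ℝ :=
  logLik p φ θ' - klDivergence θ' θ

/-- The correlation coefficient of two real random variables under `μ`. -/
def correlation {Ω : Type*} [MeasurableSpace Ω] (X Y : Ω → ℝ) (μ : Measure Ω) : ℝ :=
  covariance X Y μ / √(variance X μ * variance Y μ)

/-- The correlation `ρ_n` of `e^{n H(θ)}` and `e^{n Ĥ(θ)}` for `θ` drawn from the Dirichlet
distribution with parameter `α`. (Points where `H` or `Ĥ` is `-∞` have a zero coordinate, hence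
form a null set and do not matter.) -/
def cvCorrelation {d V : ℕ} (α : Fin (d + 1) → ℝ) (p : Fin V → ℝ) (φ : Fin (d + 1) → Fin V → ℝ)
    (θ' : Fin (d + 1) → ℝ) (n : ℝ) : ℝ :=
  correlation (fun θ => Real.exp (n * logLik p φ θ))
    (fun θ => Real.exp (n * controlExponent p φ θ' θ)) (dirichlet α)

end LDA

end

/-! Let `F = H - H(θ*)` and `G = -KL(θ*|·)`. The factor `e^{nH(θ*)}` cancels in the correlation, and
the covariance of `e^{nF}` and `e^{nG}` is the moment of `e^{n(F+G)}`, of order `n^{-d/2}`, plus a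
multiple of a product of two moments, of order `n^{-d}` (`tendsto_covariance_exp`). So Laplace
asymptotics of the moments of `F + G`, `F + F` and `G + G` suffice. Powers of `n`, the density at
`θ*` and the Gaussian mass cancel; only determinants remain.

Up to a constant, `-KL` is itself a log-likelihood, with weights `θ*` and unit vectors as topics
(`klDivergence_eq`), so one analysis under `IsRegular` serves both functions. In the coordinates `y`
each is a sum of `w_v log(1 + ℓ_v(y - y₀))`. Stationarity kills the linear terms, and
`log_one_add_le` then puts the exponent below `-c‖y - y₀‖²` on the whole open simplex. This one
bound localizes the integral and dominates the rescaled integrand, even if the Dirichlet density is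
unbounded.

Laplace's method yields determinants of Hessians compressed to the tangent space. They agree with
the full `K × K` determinants because the negative Hessians map `θ*` to the all-ones vector
(`fisherMatrix_mulVec`, `det_tangentMatrix_compression`). -/

namespace LDA

/-! ### Elementary estimates for the logarithm -/

/-- A quadratic upper bound for `log (1 + t)` on bounded ranges of `t`. -/
theorem log_one_add_le {t M : ℝ} (ht : 0 < 1 + t) (htM : t ≤ M) :
    Real.log (1 + t) ≤ t - ((√(1 + M) + 1) ^ 2)⁻¹ * t ^ 2 := by
  -- With `u = √(1+t)`, `log(1+t) = 2 log u ≤ 2(u-1) = t - (u-1)²`, and `u - 1 = t/(u+1)`.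
  set u := √(1 + t) with hu
  have hu0 : 0 < u := Real.sqrt_pos.2 ht
  have hsq : u ^ 2 = 1 + t := Real.sq_sqrt ht.le
  have huM : u ≤ √(1 + M) := Real.sqrt_le_sqrt (by linarith)
  have h1 : Real.log (1 + t) ≤ 2 * (u - 1) := by
    rw [← hsq, Real.log_pow]
    have := Real.log_le_sub_one_of_pos hu0
    push_cast
    linarith
  have h2 : ((√(1 + M) + 1) ^ 2)⁻¹ * t ^ 2 ≤ (u - 1) ^ 2 := by
    rw [inv_mul_le_iff₀ (by positivity)]
    have ht' : t = (u + 1) * (u - 1) := by linarith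
    rw [ht', mul_pow]
    gcongr
  nlinarith

/-- The second order Taylor limit of `log (1 + t / √n)`. -/
theorem tendsto_mul_log_one_add_div_sqrt (t : ℝ) :
    Tendsto (fun n : ℝ => n * Real.log (1 + t / √n) - √n * t) atTop (𝓝 (-(t ^ 2 / 2))) := by
  have hs : Tendsto (fun n : ℝ => √n) atTop atTop := Real.tendsto_sqrt_atTop
  have hz : Tendsto (fun n : ℝ => t / √n) atTop (𝓝 0) := hs.const_div_atTop t
  have hsmall : ∀ᶠ n : ℝ in atTop, |t / √n| < 1 := by
    have := hz.abs
    rw [abs_zero] at this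
    exact this.eventually_lt_const one_pos
  rw [tendsto_iff_norm_sub_tendsto_zero]
  have hb : Tendsto (fun n : ℝ => t ^ 2 * |t / √n| / (1 - |t / √n|)) atTop (𝓝 0) := by
    have h1 := hz.abs
    rw [abs_zero] at h1
    have := (h1.const_mul (t ^ 2)).div (h1.const_sub 1) (by norm_num)
    rw [mul_zero, zero_div] at this
    exact this
  refine squeeze_zero' (Eventually.of_forall fun n => norm_nonneg _) ?_ hb
  filter_upwards [hsmall, eventually_gt_atTop 0] with n hn hn0
  have hs0 : 0 < √n := Real.sqrt_pos.2 hn0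
  have hsn : √n ^ 2 = n := Real.sq_sqrt hn0.le
  have hx : |-(t / √n)| < 1 := by rwa [abs_neg]
  -- The remainder after two terms is at most `|x|³/(1-|x|)` with `x = t/√n`; multiplied by `n` it
  -- is the bound `hb`.
  have key := Real.abs_log_sub_add_sum_range_le hx 2
  rw [abs_neg] at key
  simp only [Finset.sum_range_succ, Finset.sum_range_zero, sub_neg_eq_add] at key
  have e : n * Real.log (1 + t / √n) - √n * t - -(t ^ 2 / 2)
      = n * (0 + (-(t / √n)) ^ (0 + 1) / ((0 : ℕ) + 1) + (-(t / √n)) ^ (1 + 1) / ((1 : ℕ) + 1)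
        + Real.log (1 + t / √n)) := by
    have h1 : n * (t / √n) = √n * t := by
      field_simp
      rw [hsn]; ring
    have h2 : n * (t / √n) ^ 2 = t ^ 2 := by
      rw [div_pow, hsn]; field_simp
    push_cast
    linear_combination h1 - h2 / 2
  rw [e, norm_mul, Real.norm_of_nonneg hn0.le, Real.norm_eq_abs]
  refine (mul_le_mul_of_nonneg_left key hn0.le).trans (le_of_eq ?_)
  have h2 : n * |t / √n| ^ 2 = t ^ 2 := by
    rw [sq_abs, div_pow, hsn]; field_simp
  rw [← h2]; ring

/-! ### Gaussian integrals -/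

theorem integrable_exp_neg_mul_norm_sq (d : ℕ) {c : ℝ} (hc : 0 < c) :
    Integrable (fun z : Fin d → ℝ => Real.exp (-c * ‖z‖ ^ 2)) := by
  -- The norm is the sup norm, so `∑ z_i² ≤ d‖z‖²`; `d + 1` in place of `d` also covers `d = 0`.
  have hc' : 0 < c / (d + 1) := by positivity
  have h := Integrable.fintype_prod (ι := Fin d) (μ := fun _ => (volume : Measure ℝ))
    (f := fun _ x => Real.exp (-(c / (d + 1)) * x ^ 2)) fun _ => integrable_exp_neg_mul_sq hc'
  refine Integrable.mono' h (by fun_prop) (ae_of_all _ fun z => ?_)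
  rw [Real.norm_of_nonneg (Real.exp_pos _).le, ← Real.exp_sum, Real.exp_le_exp, ← Finset.mul_sum]
  have hsum : ∑ i, z i ^ 2 ≤ (d + 1) * ‖z‖ ^ 2 := by
    calc ∑ i, z i ^ 2 ≤ ∑ _i : Fin d, ‖z‖ ^ 2 := by
          refine Finset.sum_le_sum fun i _ => ?_
          rw [← sq_abs]
          exact pow_le_pow_left₀ (abs_nonneg _) (norm_le_pi_norm z i) 2
      _ = d * ‖z‖ ^ 2 := by simp
      _ ≤ (d + 1) * ‖z‖ ^ 2 := by gcongr; linarith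
  have := mul_le_mul_of_nonneg_left hsum hc'.le
  have e : c / (d + 1) * ((d + 1) * ‖z‖ ^ 2) = c * ‖z‖ ^ 2 := by field_simp
  linarith

/-- The integral of the standard Gaussian weight on `ℝ^d`. -/
noncomputable def gaussianMass (d : ℕ) : ℝ :=
  ∫ z : Fin d → ℝ, Real.exp (-(z ⬝ᵥ z / 2))

theorem gaussianMass_pos (d : ℕ) : 0 < gaussianMass d := by
  have e : gaussianMass d = ∫ z : Fin d → ℝ, ∏ i, Real.exp (-(1 / 2) * z i ^ 2) := by
    refine integral_congr_ae (ae_of_all _ fun z => ?_)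
    simp only [← Real.exp_sum, dotProduct, ← Finset.mul_sum]
    congr 1
    rw [Finset.sum_congr rfl fun i _ => (sq (z i)).symm]
    ring
  rw [e, integral_fintype_prod_volume_eq_prod fun _ x => Real.exp (-(1 / 2) * x ^ 2)]
  refine Finset.prod_pos fun i _ => ?_
  rw [integral_gaussian]
  positivity

-- Write `M = BᵀB` and substitute `z ↦ Bz`, whose Jacobian is `|det B| = √(det M)`.
open scoped MatrixOrder in
theorem integral_exp_neg_quadratic {d : ℕ} {M : Matrix (Fin d) (Fin d) ℝ} (hM : M.PosDef) :
    ∫ z : Fin d → ℝ, Real.exp (-(z ⬝ᵥ M.mulVec z / 2)) = gaussianMass d / √M.det := by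
  obtain ⟨B, hB⟩ := CStarAlgebra.nonneg_iff_eq_star_mul_self.1 hM.posSemidef.nonneg
  have hdet : M.det = B.det ^ 2 := by
    rw [hB, Matrix.det_mul, Matrix.star_eq_conjTranspose, Matrix.det_conjTranspose]
    simp [sq]
  have hB0 : B.det ≠ 0 := by
    intro h
    have := hM.det_pos
    rw [hdet, h] at this
    simp at this
  have hmap := Real.map_matrix_volume_pi_eq_smul_volume_pi hB0
  have hI : ∫ z : Fin d → ℝ, Real.exp (-(z ⬝ᵥ M.mulVec z / 2))
      = ∫ z : Fin d → ℝ, Real.exp (-(z ⬝ᵥ z / 2)) ∂(Measure.map (Matrix.toLin' B) volume) := by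
    rw [integral_map]
    · refine integral_congr_ae (ae_of_all _ fun z => ?_)
      simp only [Matrix.toLin'_apply]
      congr 3
      rw [hB, ← Matrix.mulVec_mulVec, Matrix.dotProduct_mulVec, Matrix.star_eq_conjTranspose,
        Matrix.vecMul_conjTranspose]
      simp
    · exact (LinearMap.continuous_of_finiteDimensional _).measurable.aemeasurable
    · exact Continuous.aestronglyMeasurable (by fun_prop)
  rw [hI, hmap, integral_smul_measure, hdet, Real.sqrt_sq_eq_abs, gaussianMass,
    ENNReal.toReal_ofReal (abs_nonneg _), abs_inv, smul_eq_mul, div_eq_inv_mul]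

/-! ### Laplace's method -/

theorem tendsto_sqrt_pow_mul_exp_neg (d : ℕ) {c : ℝ} (hc : 0 < c) :
    Tendsto (fun n : ℝ => √n ^ d * Real.exp (-c * n)) atTop (𝓝 0) := by
  refine (tendsto_rpow_mul_exp_neg_mul_atTop_nhds_zero (d / 2) c hc).congr' ?_
  filter_upwards [eventually_ge_atTop 0] with n hn
  rw [Real.sqrt_eq_rpow, ← Real.rpow_mul_natCast hn]
  congr 2
  ring

/-- **Laplace's method** for an exponent that lies below a negative definite quadratic function. -/
theorem tendsto_laplace {d : ℕ} {S : Set (Fin d → ℝ)} (hS : MeasurableSet S)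
    {y₀ : Fin d → ℝ} (hy₀ : S ∈ 𝓝 y₀) {f g q : (Fin d → ℝ) → ℝ} (hf : Measurable f)
    (hg : Measurable g) (hgS : IntegrableOn g S) (hgc : ContinuousAt g y₀) {c : ℝ} (hc : 0 < c)
    (hle : ∀ y ∈ S, f y ≤ -c * ‖y - y₀‖ ^ 2)
    (hlim : ∀ z, Tendsto (fun n : ℝ => n * f (y₀ + (√n)⁻¹ • z)) atTop (𝓝 (-q z))) :
    Tendsto (fun n : ℝ => √n ^ d * ∫ y in S, Real.exp (n * f y) * g y) atTop
      (𝓝 (g y₀ * ∫ z, Real.exp (-q z))) := by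
  have hgb : ∀ᶠ y in 𝓝 y₀, |g y| < |g y₀| + 1 :=
    hgc.abs.eventually_lt_const (by linarith)
  obtain ⟨δ, hδ, hball⟩ := Metric.mem_nhds_iff.1 (inter_mem hy₀ hgb)
  set B := Metric.ball y₀ δ with hBdef
  have hBm : MeasurableSet B := measurableSet_ball
  have hBS : B ⊆ S := fun y hy => (hball hy).1
  have hBg : ∀ y ∈ B, |g y| ≤ |g y₀| + 1 := fun y hy => (hball hy).2.le
  have hint : ∀ n : ℝ, 0 ≤ n → IntegrableOn (fun y => Real.exp (n * f y) * g y) S := by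
    intro n hn
    refine Integrable.mono' hgS.norm (by fun_prop) ?_
    refine (ae_restrict_iff' hS).2 (ae_of_all _ fun y hy => ?_)
    rw [norm_mul, Real.norm_of_nonneg (Real.exp_pos _).le]
    refine mul_le_of_le_one_left (norm_nonneg _) (Real.exp_le_one_iff.2 ?_)
    refine mul_nonpos_of_nonneg_of_nonpos hn ((hle y hy).trans ?_)
    nlinarith [sq_nonneg ‖y - y₀‖]
  -- the part away from the maximum
  have hout : Tendsto (fun n : ℝ => √n ^ d * ∫ y in S \ B, Real.exp (n * f y) * g y) atTop
      (𝓝 0) := by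
    have h0 := (tendsto_sqrt_pow_mul_exp_neg d (c := c * δ ^ 2) (by positivity)).mul_const
      (∫ y in S \ B, ‖g y‖)
    rw [zero_mul] at h0
    refine squeeze_zero_norm' ?_ h0
    filter_upwards [eventually_ge_atTop 0] with n hn
    rw [norm_mul, Real.norm_of_nonneg (by positivity), mul_assoc]
    refine mul_le_mul_of_nonneg_left ?_ (by positivity)
    rw [← integral_const_mul]
    refine norm_integral_le_of_norm_le ((hgS.mono_set Set.sdiff_subset).norm.const_mul _) ?_
    refine (ae_restrict_iff' (hS.diff hBm)).2 (ae_of_all _ fun y hy => ?_)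
    rw [norm_mul, Real.norm_of_nonneg (Real.exp_pos _).le]
    refine mul_le_mul_of_nonneg_right (Real.exp_le_exp.2 ?_) (norm_nonneg _)
    have h1 : δ ≤ ‖y - y₀‖ := by
      have := hy.2
      rw [hBdef, Metric.mem_ball, dist_eq_norm, not_lt] at this
      exact this
    have h2 : δ ^ 2 ≤ ‖y - y₀‖ ^ 2 := pow_le_pow_left₀ hδ.le h1 2
    have h3 := hle y hy.1
    have h4 := mul_le_mul_of_nonneg_left h2 hc.le
    have h5 : f y ≤ -(c * δ ^ 2) := by linarith
    have := mul_le_mul_of_nonneg_left h5 hn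
    linarith
  -- the part near the maximum, rescaled
  have hin : Tendsto (fun n : ℝ => √n ^ d * ∫ y in B, Real.exp (n * f y) * g y) atTop
      (𝓝 (g y₀ * ∫ z, Real.exp (-q z))) := by
    rw [← integral_const_mul]
    have hdct : Tendsto (fun n : ℝ => ∫ z : Fin d → ℝ,
        B.indicator (fun y => Real.exp (n * f y) * g y) (y₀ + (√n)⁻¹ • z)) atTop
        (𝓝 (∫ z, g y₀ * Real.exp (-q z))) := by
      -- Since `n‖z/√n‖² = ‖z‖²`, the bound `hle` gives a Gaussian majorant independent of `n`.
      refine tendsto_integral_filter_of_dominated_convergence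
        (fun z => (|g y₀| + 1) * Real.exp (-c * ‖z‖ ^ 2)) ?_ ?_
        ((integrable_exp_neg_mul_norm_sq d hc).const_mul _) ?_
      · refine Eventually.of_forall fun n => ?_
        have h1 : Measurable (B.indicator fun y => Real.exp (n * f y) * g y) :=
          Measurable.indicator (by fun_prop) hBm
        exact (h1.comp (g := B.indicator fun y => Real.exp (n * f y) * g y)
          (f := fun z : Fin d → ℝ => y₀ + (√n)⁻¹ • z) (by fun_prop)).aestronglyMeasurable
      · filter_upwards [eventually_gt_atTop 0] with n hn
        refine ae_of_all _ fun z => ?_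
        by_cases hz : y₀ + (√n)⁻¹ • z ∈ B
        · rw [Set.indicator_of_mem hz, norm_mul, Real.norm_of_nonneg (Real.exp_pos _).le, mul_comm]
          refine mul_le_mul (hBg _ hz) (Real.exp_le_exp.2 ?_) (Real.exp_pos _).le (by positivity)
          have h1 := mul_le_mul_of_nonneg_left (hle _ (hBS hz)) hn.le
          refine h1.trans (le_of_eq ?_)
          rw [add_sub_cancel_left, norm_smul, mul_pow, norm_inv, Real.norm_of_nonneg
            (Real.sqrt_nonneg n), inv_pow, Real.sq_sqrt hn.le]
          field_simp
        · rw [Set.indicator_of_notMem hz, norm_zero]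
          positivity
      · refine ae_of_all _ fun z => ?_
        have hto : Tendsto (fun n : ℝ => y₀ + (√n)⁻¹ • z) atTop (𝓝 y₀) := by
          have h1 := (tendsto_inv_atTop_zero.comp Real.tendsto_sqrt_atTop).smul_const z
          have h2 := h1.const_add y₀
          simpa using h2
        have hmem : ∀ᶠ n : ℝ in atTop, y₀ + (√n)⁻¹ • z ∈ B :=
          hto.eventually (Metric.ball_mem_nhds y₀ hδ)
        have h1 := ((Real.continuous_exp.tendsto _).comp (hlim z)).mul (hgc.tendsto.comp hto)
        rw [mul_comm (g y₀)]
        refine h1.congr' ?_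
        filter_upwards [hmem] with n hn
        rw [Set.indicator_of_mem hn]
        rfl
    refine hdct.congr' ?_
    filter_upwards [eventually_gt_atTop 0] with n hn
    have hs0 : 0 < √n := Real.sqrt_pos.2 hn
    rw [Measure.integral_comp_smul volume (fun z => B.indicator
      (fun y => Real.exp (n * f y) * g y) (y₀ + z)), integral_add_left_eq_self
      (fun y => B.indicator (fun y => Real.exp (n * f y) * g y) y), integral_indicator hBm,
      Module.finrank_fin_fun, inv_pow, inv_inv, abs_of_nonneg (by positivity), smul_eq_mul]
  have := hin.add hout
  rw [add_zero] at this
  refine this.congr' ?_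
  filter_upwards [eventually_ge_atTop 0] with n hn
  rw [← mul_add, ← integral_inter_add_sdiff hBm (hint n hn), Set.inter_eq_right.2 hBS]

/-- Laplace's method for a mixture of logarithms `∑ v, w v * log (1 + ℓ v (y - y₀))`. -/
theorem tendsto_laplace_log {d : ℕ} {ι : Type*} [Fintype ι] {S : Set (Fin d → ℝ)}
    (hS : MeasurableSet S) (hSb : Bornology.IsBounded S) {y₀ : Fin d → ℝ} (hy₀ : S ∈ 𝓝 y₀)
    {g : (Fin d → ℝ) → ℝ} (hg : Measurable g) (hgS : IntegrableOn g S) (hgc : ContinuousAt g y₀)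
    {w : ι → ℝ} (hw : ∀ v, 0 ≤ w v) {l : ι → (Fin d → ℝ) →ₗ[ℝ] ℝ}
    (hpos : ∀ y ∈ S, ∀ v, 0 < w v → 0 < 1 + l v (y - y₀))
    (hl : ∀ x, ∑ v, w v * l v x = 0) (hinj : ∀ x, (∀ v, 0 < w v → l v x = 0) → x = 0) :
    Tendsto (fun n : ℝ => √n ^ d *
        ∫ y in S, Real.exp (n * ∑ v, w v * Real.log (1 + l v (y - y₀))) * g y) atTop
      (𝓝 (g y₀ * ∫ z, Real.exp (-((∑ v, w v * l v z ^ 2) / 2)))) := by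
  have hlc : ∀ v, Continuous (l v) := fun v => LinearMap.continuous_of_finiteDimensional _
  -- a lower bound for the quadratic form
  obtain ⟨κ, hκ, hquad⟩ : ∃ κ : ℝ, 0 < κ ∧ ∀ x, κ * ‖x‖ ^ 2 ≤ ∑ v, w v * l v x ^ 2 := by
    -- The quadratic form is the sum of squared coordinates of `T x`. By `hinj`, `T` is injective,
    -- hence bounded below in finite dimension.
    let T : (Fin d → ℝ) →ₗ[ℝ] (ι → ℝ) := LinearMap.pi fun v => √(w v) • l v
    have hker : T.ker = ⊥ := by
      rw [LinearMap.ker_eq_bot']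
      intro x hx
      refine hinj x fun v hv => ?_
      have := congrFun hx v
      simp only [T, LinearMap.pi_apply, LinearMap.smul_apply, smul_eq_mul, Pi.zero_apply,
        mul_eq_zero] at this
      exact this.resolve_left (Real.sqrt_pos.2 hv).ne'
    obtain ⟨K, hK, hT⟩ := T.exists_antilipschitzWith hker
    have hK' : (0 : ℝ) < K := hK
    refine ⟨((K : ℝ) ^ 2)⁻¹, by positivity, fun x => ?_⟩
    rw [inv_mul_le_iff₀ (by positivity)]
    have h1 : ‖x‖ ≤ K * ‖T x‖ := by
      have := hT.le_mul_dist x 0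
      simpa using this
    have h2 : ‖T x‖ ≤ √(∑ v, w v * l v x ^ 2) := by
      refine (pi_norm_le_iff_of_nonneg (Real.sqrt_nonneg _)).2 fun v => ?_
      refine Real.le_sqrt_of_sq_le ?_
      have : ‖T x v‖ ^ 2 = w v * l v x ^ 2 := by
        simp only [T, LinearMap.pi_apply, LinearMap.smul_apply, smul_eq_mul, Real.norm_eq_abs,
          sq_abs, mul_pow, Real.sq_sqrt (hw v)]
      rw [this]
      exact Finset.single_le_sum (f := fun v => w v * l v x ^ 2)
        (fun v _ => mul_nonneg (hw v) (sq_nonneg _)) (Finset.mem_univ v)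
    have hnn : 0 ≤ ∑ v, w v * l v x ^ 2 :=
      Finset.sum_nonneg fun v _ => mul_nonneg (hw v) (sq_nonneg _)
    calc ‖x‖ ^ 2 ≤ (K * √(∑ v, w v * l v x ^ 2)) ^ 2 :=
          pow_le_pow_left₀ (norm_nonneg _) (h1.trans (by gcongr)) 2
      _ = _ := by rw [mul_pow, Real.sq_sqrt hnn]
  -- an upper bound for the linear forms
  obtain ⟨M, hM⟩ : ∃ M : ℝ, ∀ y ∈ S, ∀ v, l v (y - y₀) ≤ M := by
    have hcont : Continuous fun y => ∑ v, |l v (y - y₀)| :=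
      continuous_finsetSum _ fun v _ => ((hlc v).comp (continuous_id.sub continuous_const)).abs
    obtain ⟨M, hM⟩ := (hSb.isCompact_closure.bddAbove_image hcont.continuousOn)
    refine ⟨M, fun y hy v => ?_⟩
    refine le_trans (le_trans (le_abs_self _) ?_) (hM ⟨y, subset_closure hy, rfl⟩)
    exact Finset.single_le_sum (f := fun v => |l v (y - y₀)|) (fun v _ => abs_nonneg _)
      (Finset.mem_univ v)
  set C := ((√(1 + M) + 1) ^ 2)⁻¹ with hC
  have hC0 : 0 < C := by positivity
  refine tendsto_laplace (q := fun z => (∑ v, w v * l v z ^ 2) / 2) hS hy₀ ?_ hg hgS hgc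
    (mul_pos hC0 hκ) ?_ ?_
  · refine Finset.measurable_sum _ fun v _ => ?_
    have : Measurable fun y => l v (y - y₀) :=
      ((hlc v).comp (continuous_id.sub continuous_const)).measurable
    fun_prop
  · intro y hy
    have h1 : ∑ v, w v * Real.log (1 + l v (y - y₀))
        ≤ ∑ v, (w v * l v (y - y₀) - C * (w v * l v (y - y₀) ^ 2)) := by
      refine Finset.sum_le_sum fun v _ => ?_
      rcases (hw v).eq_or_lt with h | h
      · simp [← h]
      · have := mul_le_mul_of_nonneg_left (log_one_add_le (hpos y hy v h) (hM y hy v)) h.le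
        linarith
    -- The first-order terms vanish by `hl`, which leaves a negative definite bound valid on all of
    -- `S`.
    rw [Finset.sum_sub_distrib, hl, ← Finset.mul_sum] at h1
    have := mul_le_mul_of_nonneg_left (hquad (y - y₀)) hC0.le
    linarith
  · intro z
    have h1 : Tendsto (fun n : ℝ => ∑ v, w v * (n * Real.log (1 + l v z / √n) - √n * l v z)) atTop
        (𝓝 (∑ v, w v * -(l v z ^ 2 / 2))) :=
      tendsto_finsetSum _ fun v _ => (tendsto_mul_log_one_add_div_sqrt _).const_mul _
    have e : ∑ v, w v * -(l v z ^ 2 / 2) = -((∑ v, w v * l v z ^ 2) / 2) := by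
      rw [Finset.sum_div, ← Finset.sum_neg_distrib]
      exact Finset.sum_congr rfl fun v _ => by ring
    rw [e] at h1
    refine h1.congr fun n => ?_
    -- The divergent terms `√n ℓ_v(z)` subtracted in `h1` have weighted sum zero.
    have h2 : ∑ v, w v * (√n * l v z) = 0 := by
      rw [← mul_zero (√n), ← hl z, Finset.mul_sum]
      exact Finset.sum_congr rfl fun v _ => by ring
    simp only [mul_sub, Finset.sum_sub_distrib]
    rw [h2, sub_zero, Finset.mul_sum]
    refine Finset.sum_congr rfl fun v _ => ?_
    rw [add_sub_cancel_left, map_smul, smul_eq_mul, div_eq_inv_mul]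
    ring

/-! ### The simplex in the coordinates `y` -/

theorem simplexMap_castSucc {d : ℕ} (y : Fin d → ℝ) (i : Fin d) :
    simplexMap d y i.castSucc = y i := by
  simp [simplexMap]

theorem simplexMap_last {d : ℕ} (y : Fin d → ℝ) :
    simplexMap d y (Fin.last d) = 1 - ∑ i, y i := by
  simp [simplexMap]

theorem sum_simplexMap {d : ℕ} (y : Fin d → ℝ) : ∑ k, simplexMap d y k = 1 := by
  simp [Fin.sum_univ_castSucc, simplexMap_castSucc, simplexMap_last]

theorem continuous_simplexMap (d : ℕ) : Continuous (simplexMap d) := by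
  refine continuous_pi fun i => ?_
  refine Fin.lastCases ?_ (fun j => ?_) i
  · simp only [simplexMap_last]
    fun_prop
  · simp only [simplexMap_castSucc]
    fun_prop

theorem simplexMap_init {d : ℕ} {θ : Fin (d + 1) → ℝ} (hθ : ∑ k, θ k = 1) :
    simplexMap d (fun i => θ i.castSucc) = θ := by
  rw [Fin.sum_univ_castSucc] at hθ
  funext k
  refine Fin.lastCases ?_ (fun j => ?_) k
  · rw [simplexMap_last]
    linarith
  · rw [simplexMap_castSucc]

/-- The points of the projected simplex whose barycentric coordinates are all positive. -/
def posSimplex (d : ℕ) : Set (Fin d → ℝ) :=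
  {y | ∀ k, 0 < simplexMap d y k}

theorem isOpen_posSimplex (d : ℕ) : IsOpen (posSimplex d) := by
  have : posSimplex d = ⋂ k, {y | 0 < simplexMap d y k} := by
    ext
    simp [posSimplex]
  rw [this]
  exact isOpen_iInter_of_finite fun k =>
    isOpen_lt continuous_const ((continuous_apply k).comp (continuous_simplexMap d))

theorem simplexMap_le_one {d : ℕ} {y : Fin d → ℝ} (hy : y ∈ posSimplex d) (k : Fin (d + 1)) :
    simplexMap d y k ≤ 1 := by
  rw [← sum_simplexMap y]
  exact Finset.single_le_sum (fun k _ => (hy k).le) (Finset.mem_univ k)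

theorem isBounded_posSimplex (d : ℕ) : Bornology.IsBounded (posSimplex d) := by
  refine (Metric.isBounded_Icc (0 : Fin d → ℝ) 1).subset fun y hy => ⟨fun i => ?_, fun i => ?_⟩
  · rw [← simplexMap_castSucc y i]
    exact (hy _).le
  · rw [← simplexMap_castSucc y i]
    exact simplexMap_le_one hy _

/-- The involution of `ℝ^d` that exchanges the barycentric coordinates `i` and `d + 1`. -/
def swapLast {d : ℕ} (i : Fin d) (y : Fin d → ℝ) : Fin d → ℝ :=
  Function.update y i (1 - ∑ j, y j)

theorem sum_update {d : ℕ} (i : Fin d) (y : Fin d → ℝ) (a : ℝ) :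
    ∑ j, Function.update y i a j = a + ∑ j, y j - y i := by
  rw [Finset.sum_update_of_mem (Finset.mem_univ i), Finset.sum_sdiff_eq_sub (by simp)]
  simp
  ring

theorem simplexMap_swapLast {d : ℕ} (i : Fin d) (y : Fin d → ℝ) (k : Fin (d + 1)) :
    simplexMap d (swapLast i y) k = simplexMap d y (Equiv.swap i.castSucc (Fin.last d) k) := by
  refine Fin.lastCases ?_ (fun j => ?_) k
  · rw [Equiv.swap_apply_right, simplexMap_castSucc, simplexMap_last, swapLast, sum_update]
    ring
  · rw [simplexMap_castSucc, swapLast]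
    rcases eq_or_ne j i with rfl | h
    · rw [Equiv.swap_apply_left, simplexMap_last, Function.update_self]
    · rw [Function.update_of_ne h, Equiv.swap_apply_of_ne_of_ne, simplexMap_castSucc]
      · exact fun h' => h (Fin.castSucc_injective _ h')
      · exact (Fin.castSucc_lt_last j).ne

/-- The linear part is an involution, so its determinant is `±1`; the rest is a translation. This
symmetry lets the last barycentric coordinate be treated like the others. -/
theorem measurePreserving_swapLast {d : ℕ} (i : Fin d) :
    MeasurePreserving (swapLast i) volume volume := by
  let L : (Fin d → ℝ) →ₗ[ℝ] (Fin d → ℝ) :=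
    { toFun := fun y => Function.update y i (-∑ j, y j)
      map_add' := fun x y => by
        funext k
        rcases eq_or_ne k i with rfl | h
        · simp [Finset.sum_add_distrib]
          ring
        · simp [h]
      map_smul' := fun c y => by
        funext k
        rcases eq_or_ne k i with rfl | h
        · simp [Finset.mul_sum]
        · simp [h] }
  have hL : ∀ y, L y = Function.update y i (-∑ j, y j) := fun _ => rfl
  have hLL : L ∘ₗ L = LinearMap.id := by
    refine LinearMap.ext fun y => ?_
    rw [LinearMap.comp_apply, hL (L y), hL y, sum_update]
    simp
  have hdet : |LinearMap.det L| = 1 := by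
    have h := congrArg LinearMap.det hLL
    rw [LinearMap.det_comp, LinearMap.det_id, ← sq] at h
    exact (pow_eq_one_iff_of_nonneg (abs_nonneg _) two_ne_zero).1 (by rw [sq_abs, h])
  have hdet0 : LinearMap.det L ≠ 0 := by
    intro h
    simp [h] at hdet
  have hLc : Continuous L := LinearMap.continuous_of_finiteDimensional L
  have h1 : MeasurePreserving L volume volume := by
    refine ⟨hLc.measurable, ?_⟩
    rw [Measure.map_linearMap_addHaar_eq_smul_addHaar volume hdet0, abs_inv, hdet]
    simp
  have h2 := (measurePreserving_add_right volume (Pi.single i (1 : ℝ) : Fin d → ℝ)).comp h1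
  convert h2 using 1
  funext y
  funext k
  rw [Function.comp_apply, Pi.add_apply, hL, swapLast]
  rcases eq_or_ne k i with rfl | h
  · simp
    ring
  · simp [h]

/-- The two sets differ only on the faces. Coordinate hyperplanes are null, and `swapLast` carries
the last face to one of them. -/
theorem projSimplex_ae_eq_posSimplex {d : ℕ} (hd : 1 ≤ d) :
    projSimplex d =ᵐ[volume] posSimplex d := by
  have hnull : ∀ k, volume {y : Fin d → ℝ | simplexMap d y k = 0} = 0 := by
    have hcast : ∀ i : Fin d, volume {y : Fin d → ℝ | simplexMap d y i.castSucc = 0} = 0 := by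
      intro i
      simp only [simplexMap_castSucc]
      exact Measure.pi_hyperplane (fun _ : Fin d => (volume : Measure ℝ)) i 0
    intro k
    refine Fin.lastCases ?_ hcast k
    have i : Fin d := ⟨0, hd⟩
    have h := (measurePreserving_swapLast i).measure_preimage
      (s := {y : Fin d → ℝ | simplexMap d y i.castSucc = 0}) (measurableSet_eq_fun
        ((measurable_pi_apply _).comp (measurable_simplexMap d))
        measurable_const).nullMeasurableSet
    rw [hcast i] at h
    simpa only [Set.preimage_ofPred_eq, simplexMap_swapLast, Equiv.swap_apply_left] using h
  have hae : ∀ᵐ y : Fin d → ℝ, ∀ k, simplexMap d y k ≠ 0 :=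
    ae_all_iff.2 fun k => by rw [ae_iff]; simpa using hnull k
  filter_upwards [hae] with y hy
  refine propext ⟨fun h => fun k => ?_, fun h => ⟨fun i => ?_, ?_⟩⟩
  · refine lt_of_le_of_ne ?_ (hy k).symm
    refine Fin.lastCases ?_ (fun j => ?_) k
    · rw [simplexMap_last]
      linarith [h.2]
    · rw [simplexMap_castSucc]
      exact h.1 j
  · rw [← simplexMap_castSucc y i]
    exact (h _).le
  · have := h (Fin.last d)
    rw [simplexMap_last] at this
    linarith

/-! ### Integrability of the Dirichlet density -/

theorem rpow_le_add_of_mem_Icc {a b t : ℝ} (ha : 0 < a) (hat : a ≤ t) (ht1 : t ≤ 1) :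
    t ^ b ≤ 1 + a ^ b := by
  rcases le_total 0 b with h | h
  · have := Real.rpow_le_one (ha.trans_le hat).le ht1 h
    have := Real.rpow_nonneg ha.le b
    linarith
  · have := Real.rpow_le_rpow_of_nonpos ha hat h
    linarith

theorem measurable_prod_simplexMap_rpow {d : ℕ} (β : Fin (d + 1) → ℝ) :
    Measurable fun y => ∏ k, simplexMap d y k ^ β k := by
  refine Finset.measurable_prod _ fun k _ => ?_
  have : Measurable fun y => simplexMap d y k :=
    (measurable_pi_apply k).comp (measurable_simplexMap d)
  fun_prop

/-- Away from the last face the last factor is bounded, whatever the sign of its exponent; the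
others form a product of integrable functions of one variable. -/
theorem integrableOn_prod_simplexMap_rpow_last {d : ℕ} {α : Fin (d + 1) → ℝ}
    (hα : ∀ k, 0 < α k) {ε : ℝ} (hε : 0 < ε) :
    IntegrableOn (fun y => ∏ k, simplexMap d y k ^ (α k - 1))
      (posSimplex d ∩ {y | ε ≤ simplexMap d y (Fin.last d)}) := by
  have h1 : ∀ i : Fin d, Integrable
      ((Set.Ioc (0 : ℝ) 1).indicator fun x => x ^ (α i.castSucc - 1)) := by
    intro i
    rw [integrable_indicator_iff measurableSet_Ioc,
      ← intervalIntegrable_iff_integrableOn_Ioc_of_le zero_le_one]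
    exact intervalIntegral.intervalIntegrable_rpow' (by linarith [hα i.castSucc])
  have h2 := (Integrable.fintype_prod (μ := fun _ : Fin d => (volume : Measure ℝ)) h1).const_mul
    (1 + ε ^ (α (Fin.last d) - 1))
  have hm : MeasurableSet (posSimplex d ∩ {y | ε ≤ simplexMap d y (Fin.last d)}) :=
    (isOpen_posSimplex d).measurableSet.inter (measurableSet_le measurable_const
      ((measurable_pi_apply _).comp (measurable_simplexMap d)))
  refine Integrable.mono' (Integrable.integrableOn h2)
    (measurable_prod_simplexMap_rpow _).aestronglyMeasurable ?_
  refine (ae_restrict_iff' hm).2 (ae_of_all _ fun y hy => ?_)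
  have hy' := hy.1
  rw [Real.norm_of_nonneg (Finset.prod_nonneg fun k _ => Real.rpow_nonneg (hy' k).le _),
    Fin.prod_univ_castSucc, mul_comm]
  refine mul_le_mul (rpow_le_add_of_mem_Icc hε hy.2 (simplexMap_le_one hy' _)) (le_of_eq ?_)
    (Finset.prod_nonneg fun k _ => Real.rpow_nonneg (hy' _).le _) (by positivity)
  refine Finset.prod_congr rfl fun i _ => ?_
  have hi := hy' i.castSucc
  have hi1 := simplexMap_le_one hy' i.castSucc
  rw [simplexMap_castSucc] at hi hi1 ⊢
  exact (Set.indicator_of_mem (s := Set.Ioc (0 : ℝ) 1) ⟨hi, hi1⟩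
    fun x : ℝ => x ^ (α i.castSucc - 1)).symm

theorem integrableOn_prod_simplexMap_rpow {d : ℕ} {α : Fin (d + 1) → ℝ} (hα : ∀ k, 0 < α k) :
    IntegrableOn (fun y => ∏ k, simplexMap d y k ^ (α k - 1)) (posSimplex d) := by
  -- Some barycentric coordinate is at least the mean `1/(d+1)`. This covers the simplex by `d + 1`
  -- regions, each brought to the previous case by `swapLast`.
  have hε : (0 : ℝ) < 1 / (d + 1) := by positivity
  set ε : ℝ := 1 / (d + 1) with hεdef
  have hk : ∀ k, IntegrableOn (fun y => ∏ k, simplexMap d y k ^ (α k - 1))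
      (posSimplex d ∩ {y | ε ≤ simplexMap d y k}) := by
    intro k
    refine Fin.lastCases (integrableOn_prod_simplexMap_rpow_last hα hε) (fun i => ?_) k
    set σ := Equiv.swap i.castSucc (Fin.last d) with hσ
    have hlast := integrableOn_prod_simplexMap_rpow_last (α := fun k => α (σ k))
      (fun k => hα _) hε
    have hm : MeasurableSet (posSimplex d ∩ {y | ε ≤ simplexMap d y (Fin.last d)}) :=
      (isOpen_posSimplex d).measurableSet.inter (measurableSet_le measurable_const
        ((measurable_pi_apply _).comp (measurable_simplexMap d)))
    have hcomp := (((measurePreserving_swapLast i).restrict_preimage hm).integrable_comp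
      (measurable_prod_simplexMap_rpow _).aestronglyMeasurable).2 hlast
    have hset : swapLast i ⁻¹' (posSimplex d ∩ {y | ε ≤ simplexMap d y (Fin.last d)})
        = posSimplex d ∩ {y | ε ≤ simplexMap d y i.castSucc} := by
      ext y
      simp only [posSimplex, Set.mem_preimage, Set.mem_inter_iff, Set.mem_ofPred_eq,
        simplexMap_swapLast, Equiv.swap_apply_right]
      exact and_congr_left' (Equiv.forall_congr_right (q := fun k => 0 < simplexMap d y k) (e := σ))
    rw [hset] at hcomp
    refine hcomp.congr (ae_of_all _ fun y => ?_)
    simp only [Function.comp_apply, simplexMap_swapLast]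
    exact Equiv.prod_comp σ fun k => simplexMap d y k ^ (α k - 1)
  refine (integrableOn_finite_iUnion.2 hk).mono_set fun y hy => ?_
  obtain ⟨k, -, hk⟩ := Finset.exists_le_of_sum_le (s := Finset.univ)
    (f := fun _ : Fin (d + 1) => ε) (g := simplexMap d y) Finset.univ_nonempty (by
      rw [sum_simplexMap, hεdef]
      simp
      field_simp
      exact le_rfl)
  exact Set.mem_iUnion.2 ⟨k, hy, hk⟩

theorem multiBeta_pos {d : ℕ} {α : Fin (d + 1) → ℝ} (hα : ∀ k, 0 < α k) : 0 < multiBeta α :=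
  div_pos (Finset.prod_pos fun k _ => Real.Gamma_pos_of_pos (hα k))
    (Real.Gamma_pos_of_pos (Finset.sum_pos (fun k _ => hα k) Finset.univ_nonempty))

theorem measurable_dirichletDensity {d : ℕ} (α : Fin (d + 1) → ℝ) :
    Measurable (dirichletDensity α) :=
  (measurable_prod_simplexMap_rpow _).const_mul _

theorem dirichletDensity_pos {d : ℕ} {α : Fin (d + 1) → ℝ} (hα : ∀ k, 0 < α k)
    {y : Fin d → ℝ} (hy : y ∈ posSimplex d) : 0 < dirichletDensity α y :=
  mul_pos (inv_pos.2 (multiBeta_pos hα)) (Finset.prod_pos fun k _ => Real.rpow_pos_of_pos (hy k) _)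

theorem continuousAt_dirichletDensity {d : ℕ} (α : Fin (d + 1) → ℝ)
    {y : Fin d → ℝ} (hy : y ∈ posSimplex d) : ContinuousAt (dirichletDensity α) y := by
  refine continuousAt_const.mul (tendsto_finsetProd _ fun k _ => ?_)
  exact ((continuous_apply k).comp (continuous_simplexMap d)).continuousAt.rpow_const
    (Or.inl (hy k).ne')

theorem integrableOn_dirichletDensity {d : ℕ} {α : Fin (d + 1) → ℝ} (hα : ∀ k, 0 < α k) :
    IntegrableOn (dirichletDensity α) (posSimplex d) :=
  (integrableOn_prod_simplexMap_rpow hα).const_mul _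

theorem dirichlet_eq_map_restrict_posSimplex {d : ℕ} (hd : 1 ≤ d) (α : Fin (d + 1) → ℝ) :
    dirichlet α = (((volume : Measure (Fin d → ℝ)).restrict (posSimplex d)).withDensity
      fun y => ENNReal.ofReal (dirichletDensity α y)).map (simplexMap d) := by
  rw [dirichlet, Measure.restrict_congr_set (projSimplex_ae_eq_posSimplex hd)]

/-- Finiteness is enough: the total mass enters only a term that vanishes in the limit. -/
theorem isFiniteMeasure_dirichlet {d : ℕ} (hd : 1 ≤ d) {α : Fin (d + 1) → ℝ}
    (hα : ∀ k, 0 < α k) : IsFiniteMeasure (dirichlet α) := by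
  rw [dirichlet_eq_map_restrict_posSimplex hd]
  have := isFiniteMeasure_withDensity_ofReal (integrableOn_dirichletDensity hα).2
  infer_instance

theorem integral_dirichlet {d : ℕ} (hd : 1 ≤ d) {α : Fin (d + 1) → ℝ} (hα : ∀ k, 0 < α k)
    {F : (Fin (d + 1) → ℝ) → ℝ} (hF : Measurable F) :
    ∫ θ, F θ ∂dirichlet α
      = ∫ y in posSimplex d, F (simplexMap d y) * dirichletDensity α y := by
  rw [dirichlet_eq_map_restrict_posSimplex hd, integral_map
    (measurable_simplexMap d).aemeasurable hF.aestronglyMeasurable,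
    integral_withDensity_eq_integral_toReal_smul (measurable_dirichletDensity α).ennreal_ofReal
    (ae_of_all _ fun _ => ENNReal.ofReal_lt_top)]
  refine setIntegral_congr_fun (isOpen_posSimplex d).measurableSet fun y hy => ?_
  simp only [smul_eq_mul]
  rw [ENNReal.toReal_ofReal (dirichletDensity_pos hα hy).le, mul_comm]

theorem ae_dirichlet_of_posSimplex {d : ℕ} (hd : 1 ≤ d) (α : Fin (d + 1) → ℝ)
    {P : (Fin (d + 1) → ℝ) → Prop} (hP : MeasurableSet {θ | P θ})
    (h : ∀ y ∈ posSimplex d, P (simplexMap d y)) : ∀ᵐ θ ∂dirichlet α, P θ := by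
  rw [dirichlet_eq_map_restrict_posSimplex hd, ae_map_iff (measurable_simplexMap d).aemeasurable hP]
  refine (withDensity_absolutelyContinuous _ _).ae_le ?_
  exact (ae_restrict_iff' (isOpen_posSimplex d).measurableSet).2 (ae_of_all _ h)

/-! ### Hessians -/

/-- The negative Hessian at `θ` of `∑ v, p v * log (∑ k, θ k * φ k v)`. -/
noncomputable def fisherMatrix {K : ℕ} {ι : Type*} [Fintype ι] (p : ι → ℝ) (φ : Fin K → ι → ℝ)
    (θ : Fin K → ℝ) : Matrix (Fin K) (Fin K) ℝ :=
  Matrix.of fun i j => ∑ v, p v * (φ i v * φ j v / (∑ k, θ k * φ k v) ^ 2)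

theorem hessian_logLik {K V : ℕ} {p : Fin V → ℝ} {φ : Fin K → Fin V → ℝ} {θ : Fin K → ℝ}
    (h : ∀ v, p v ≠ 0 → ∑ k, θ k * φ k v ≠ 0) :
    hessian (logLik p φ) θ = -fisherMatrix p φ θ := by
  let L : Fin V → (Fin K → ℝ) →L[ℝ] ℝ := fun v =>
    ∑ k, φ k v • ContinuousLinearMap.proj (R := ℝ) (φ := fun _ : Fin K => ℝ) k
  have hL : ∀ v x, ∑ k, x k * φ k v = L v x := by
    intro v x
    simp [L, mul_comm]
  have hLs : ∀ v k, L v (Pi.single k 1) = φ k v := by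
    intro v k
    simp [← hL, Pi.single_apply]
  have hfun : logLik p φ = fun x => ∑ v, p v * Real.log (L v x) := by
    funext x
    simp [logLik, hL]
  simp only [hL] at h
  have h1 : ∀ x, (∀ v, p v ≠ 0 → L v x ≠ 0) →
      fderiv ℝ (logLik p φ) x = ∑ v, (p v * (L v x)⁻¹) • L v := by
    intro x hx
    refine HasFDerivAt.fderiv ?_
    rw [hfun]
    refine HasFDerivAt.fun_sum fun v _ => ?_
    -- A word of weight zero may have probability zero, where `log` is not differentiable; its term
    -- is constantly zero.
    by_cases hv : p v = 0
    · simpa [hv] using hasFDerivAt_const (0 : ℝ) x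
    · rw [mul_smul]
      exact ((L v).hasFDerivAt.log (hx v hv)).const_mul (p v)
  have h2 : fderiv ℝ (logLik p φ) =ᶠ[𝓝 θ] fun x => ∑ v, (p v * (L v x)⁻¹) • L v := by
    have : ∀ᶠ x in 𝓝 θ, ∀ v, p v ≠ 0 → L v x ≠ 0 := by
      refine eventually_all.2 fun v => ?_
      by_cases hv : p v = 0
      · simp [hv]
      · filter_upwards [(L v).continuous.continuousAt.eventually_ne (h v hv)] with x hx _
        exact hx
    exact this.mono h1
  have h3 : HasFDerivAt (fun x => ∑ v, (p v * (L v x)⁻¹) • L v)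
      (∑ v, (p v • (-(L v θ ^ 2)⁻¹ • L v)).smulRight (L v)) θ := by
    refine HasFDerivAt.fun_sum fun v _ => ?_
    refine HasFDerivAt.smul_const ?_ (L v)
    by_cases hv : p v = 0
    · simpa [hv] using hasFDerivAt_const (0 : ℝ) θ
    · exact ((hasDerivAt_inv (h v hv)).comp_hasFDerivAt θ (L v).hasFDerivAt).const_mul (p v)
  ext i j
  rw [hessian, Matrix.of_apply, h2.fderiv_eq, h3.fderiv]
  simp only [Matrix.neg_apply, fisherMatrix, Matrix.of_apply, hL, sum_apply,
    ContinuousLinearMap.smulRight_apply, smul_apply, smul_eq_mul, hLs,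
    ← Finset.sum_neg_distrib]
  refine Finset.sum_congr rfl fun v _ => ?_
  ring

theorem sum_mul_single {K : ℕ} (θ : Fin K → ℝ) (v : Fin K) :
    ∑ k, θ k * (Pi.single k 1 : Fin K → ℝ) v = θ v := by
  simp [Pi.single_apply]

/-- With the coordinates as words and unit vectors as topics, the probability of word `k` is `θ k`.
-/
theorem klDivergence_eq {K : ℕ} {θ' θ : Fin K → ℝ} (h' : ∀ k, 0 < θ' k) (h : ∀ k, 0 < θ k) :
    klDivergence θ' θ = logLik θ' (fun k => Pi.single k 1) θ'
      - logLik θ' (fun k => Pi.single k 1) θ := by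
  simp only [klDivergence, logLik, sum_mul_single, ← Finset.sum_sub_distrib]
  refine Finset.sum_congr rfl fun k _ => ?_
  rw [Real.log_div (h' k).ne' (h k).ne', mul_sub]

theorem hessian_klDivergence {K : ℕ} {θ' : Fin K → ℝ} (h' : ∀ k, 0 < θ' k) :
    hessian (klDivergence θ') θ' = fisherMatrix θ' (fun k => Pi.single k 1) θ' := by
  have h1 : klDivergence θ' =ᶠ[𝓝 θ'] fun θ => logLik θ' (fun k => Pi.single k 1) θ'
      - logLik θ' (fun k => Pi.single k 1) θ := by
    have : ∀ᶠ θ in 𝓝 θ', ∀ k, 0 < θ k := eventually_all.2 fun k =>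
      (continuous_apply k).continuousAt.eventually_const_lt (h' k)
    exact this.mono fun θ hθ => klDivergence_eq h' hθ
  have h2 : fderiv ℝ (klDivergence θ')
      =ᶠ[𝓝 θ'] fun θ => -fderiv ℝ (logLik θ' fun k => Pi.single k 1) θ := by
    refine h1.fderiv.trans (Eventually.of_forall fun θ => ?_)
    exact fderiv_const_sub _
  have h3 := hessian_logLik (p := θ') (φ := fun k => Pi.single k 1) (θ := θ') fun v _ => by
    rw [sum_mul_single]
    exact (h' v).ne'
  rw [← neg_neg (fisherMatrix _ _ _), ← h3]
  ext i j
  simp only [hessian, Matrix.of_apply, Matrix.neg_apply]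
  rw [h2.fderiv_eq, fderiv_fun_neg]
  rfl

/-! ### Restriction to the tangent space of the simplex -/

/-- The matrix of the linear part of `simplexMap`. -/
def tangentMatrix (d : ℕ) : Matrix (Fin (d + 1)) (Fin d) ℝ :=
  Matrix.of fun k i => Fin.snoc (α := fun _ => ℝ) (Pi.single i 1) (-1) k

theorem tangentMatrix_castSucc {d : ℕ} (i j : Fin d) :
    tangentMatrix d i.castSucc j = (Pi.single j 1 : Fin d → ℝ) i := by
  simp [tangentMatrix]

theorem tangentMatrix_last {d : ℕ} (j : Fin d) : tangentMatrix d (Fin.last d) j = -1 := by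
  simp [tangentMatrix]

theorem tangentMatrix_mulVec_castSucc {d : ℕ} (x : Fin d → ℝ) (i : Fin d) :
    (tangentMatrix d).mulVec x i.castSucc = x i := by
  simp [Matrix.mulVec, dotProduct, tangentMatrix_castSucc, Pi.single_apply]

theorem tangentMatrix_mulVec_last {d : ℕ} (x : Fin d → ℝ) :
    (tangentMatrix d).mulVec x (Fin.last d) = -∑ i, x i := by
  simp [Matrix.mulVec, dotProduct, tangentMatrix_last]

theorem sum_tangentMatrix {d : ℕ} (j : Fin d) : ∑ k, tangentMatrix d k j = 0 := by
  simp [Fin.sum_univ_castSucc, tangentMatrix_castSucc, tangentMatrix_last]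

theorem sum_tangentMatrix_mulVec {d : ℕ} (x : Fin d → ℝ) :
    ∑ k, (tangentMatrix d).mulVec x k = 0 := by
  simp [Fin.sum_univ_castSucc, tangentMatrix_mulVec_castSucc, tangentMatrix_mulVec_last]

theorem eq_zero_of_tangentMatrix_mulVec_eq_zero {d : ℕ} {x : Fin d → ℝ}
    (h : (tangentMatrix d).mulVec x = 0) : x = 0 := by
  funext i
  rw [← tangentMatrix_mulVec_castSucc x i, h]
  rfl

theorem simplexMap_eq_add {d : ℕ} (y y₀ : Fin d → ℝ) :
    simplexMap d y = simplexMap d y₀ + (tangentMatrix d).mulVec (y - y₀) := by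
  funext k
  refine Fin.lastCases ?_ (fun i => ?_) k
  · rw [Pi.add_apply, tangentMatrix_mulVec_last, simplexMap_last, simplexMap_last]
    simp
  · rw [Pi.add_apply, tangentMatrix_mulVec_castSucc, simplexMap_castSucc, simplexMap_castSucc]
    simp

/-- If `A θ = 1` for a vector `θ` with coordinate sum `1`, then `A` and its compression to the
tangent space of the simplex have the same determinant. -/
theorem det_tangentMatrix_compression {d : ℕ} {A : Matrix (Fin (d + 1)) (Fin (d + 1)) ℝ}
    {θ : Fin (d + 1) → ℝ} (hAθ : A.mulVec θ = 1) (hθ : ∑ k, θ k = 1) :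
    ((tangentMatrix d).transpose * A * tangentMatrix d).det = A.det := by
  let P : Matrix (Fin (d + 1)) (Fin (d + 1)) ℝ :=
    Matrix.of fun k => Fin.snoc (α := fun _ => ℝ) (tangentMatrix d k) (θ k)
  have hPc : ∀ k j, P k (Fin.castSucc j) = tangentMatrix d k j := fun k j => by simp [P]
  have hPl : ∀ k, P k (Fin.last d) = θ k := fun k => by simp [P]
  -- `U` replaces the last row by the sum of all rows. The tangent columns of `P` sum to 0 and the
  -- column `θ` to 1, so `U * P` is unitriangular.
  let U : Matrix (Fin (d + 1)) (Fin (d + 1)) ℝ := Matrix.updateRow 1 (Fin.last d) 1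
  have hUn : ∀ i, i ≠ Fin.last d → ∀ j, U i j = (1 : Matrix _ _ ℝ) i j := fun i hi j =>
    congrFun (Matrix.updateRow_ne hi) j
  have hUdet : U.det = 1 := by
    have hU : U.IsLowerTriangular := by
      intro i j hij
      have hij' : i < j := hij
      have hi : i ≠ Fin.last d := (hij'.trans_le (Fin.le_last j)).ne
      rw [hUn i hi, Matrix.one_apply_ne hij'.ne]
    rw [Matrix.det_of_isLowerTriangular _ hU]
    refine Finset.prod_eq_one fun i _ => ?_
    rcases eq_or_ne i (Fin.last d) with rfl | hi
    · simp [U]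
    · rw [hUn i hi, Matrix.one_apply_eq]
  have hUPl : ∀ j, (U * P) (Fin.last d) j = ∑ k, P k j := fun j => by
    simp [U, Matrix.mul_apply]
  have hUPc : ∀ i j, (U * P) (Fin.castSucc i) j = P i.castSucc j := fun i j => by
    rw [Matrix.mul_apply]
    simp only [hUn _ (Fin.castSucc_lt_last i).ne]
    rw [← Matrix.mul_apply, one_mul]
  have hUP : (U * P).det = 1 := by
    have hT : (U * P).IsUpperTriangular := by
      intro i j hij
      have hij' : j < i := hij
      obtain ⟨j', rfl⟩ : ∃ j' : Fin d, j'.castSucc = j :=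
        ⟨_, Fin.castSucc_castPred j (hij'.trans_le (Fin.le_last i)).ne⟩
      induction i using Fin.lastCases with
      | last => rw [hUPl]; simp only [hPc]; exact sum_tangentMatrix j'
      | cast i =>
        rw [hUPc, hPc, tangentMatrix_castSucc, Pi.single_eq_of_ne]
        rintro rfl
        exact lt_irrefl _ hij'
    rw [Matrix.det_of_isUpperTriangular hT]
    refine Finset.prod_eq_one fun i _ => ?_
    induction i using Fin.lastCases with
    | last => rw [hUPl]; simp only [hPl]; exact hθ
    | cast i => rw [hUPc, hPc, tangentMatrix_castSucc, Pi.single_eq_same]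
  have hP : P.det = 1 := by
    rw [Matrix.det_mul, hUdet, one_mul] at hUP
    exact hUP
  -- As `Aθ = 1`, the last column of `N` holds the column sums of `P`: zeros, then a final 1.
  -- Expansion along it leaves the compression of `A`.
  set N := P.transpose * A * P with hN
  have hNdet : N.det = A.det := by
    rw [hN, Matrix.det_mul, Matrix.det_mul, Matrix.det_transpose, hP, one_mul, mul_one]
  have hAP : ∀ k, (A * P) k (Fin.last d) = 1 := by
    intro k
    have := congrFun hAθ k
    rw [Pi.one_apply] at this
    rw [← this, Matrix.mul_apply]
    simp [hPl, Matrix.mulVec, dotProduct]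
  have hNl : ∀ i, N i (Fin.last d) = ∑ k, P k i := by
    intro i
    rw [hN, Matrix.mul_assoc, Matrix.mul_apply]
    simp [hAP]
  have hNc : ∀ i j, N (Fin.castSucc i) (Fin.castSucc j)
      = ((tangentMatrix d).transpose * A * tangentMatrix d) i j := by
    intro i j
    simp only [hN, Matrix.mul_apply, Matrix.transpose_apply, hPc]
  rw [← hNdet, Matrix.det_succ_column N (Fin.last d), Fin.sum_univ_castSucc,
    Finset.sum_eq_zero, zero_add]
  · rw [hNl]
    simp only [hPl, hθ, Fin.succAbove_last]
    rw [← two_mul, pow_mul]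
    simp only [even_two, Even.neg_pow, one_pow, mul_one, one_mul]
    congr 1
    ext i j
    exact (hNc i j).symm
  · intro i _
    rw [hNl]
    simp only [hPc]
    rw [sum_tangentMatrix, mul_zero, zero_mul]

theorem fisherMatrix_isSymm {K : ℕ} {ι : Type*} [Fintype ι] (p : ι → ℝ) (φ : Fin K → ι → ℝ)
    (θ : Fin K → ℝ) : (fisherMatrix p φ θ).IsSymm := by
  ext i j
  simp [fisherMatrix, mul_comm]

/-- The quadratic form of the Fisher matrix. -/
theorem dotProduct_fisherMatrix_mulVec {K : ℕ} {ι : Type*} [Fintype ι] (p : ι → ℝ)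
    (φ : Fin K → ι → ℝ) (θ u : Fin K → ℝ) :
    u ⬝ᵥ (fisherMatrix p φ θ).mulVec u
      = ∑ v, p v * ((∑ k, u k * φ k v) / ∑ k, θ k * φ k v) ^ 2 := by
  have h1 : ∀ v, p v * ((∑ k, u k * φ k v) / ∑ k, θ k * φ k v) ^ 2
      = ∑ i, ∑ j, u i * (p v * (φ i v * φ j v / (∑ k, θ k * φ k v) ^ 2) * u j) := by
    intro v
    rw [div_pow, sq (∑ k, u k * φ k v), Finset.sum_mul_sum, Finset.sum_div, Finset.mul_sum]
    refine Finset.sum_congr rfl fun i _ => ?_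
    rw [Finset.sum_div, Finset.mul_sum]
    refine Finset.sum_congr rfl fun j _ => ?_
    ring
  simp only [h1]
  rw [Finset.sum_comm]
  simp only [dotProduct, Matrix.mulVec, fisherMatrix, Matrix.of_apply, Finset.mul_sum,
    Finset.sum_mul]
  exact Finset.sum_congr rfl fun i _ => Finset.sum_comm

theorem dotProduct_compression_mulVec {d : ℕ} (A : Matrix (Fin (d + 1)) (Fin (d + 1)) ℝ)
    (z : Fin d → ℝ) :
    z ⬝ᵥ ((tangentMatrix d).transpose * A * tangentMatrix d).mulVec z
      = (tangentMatrix d).mulVec z ⬝ᵥ A.mulVec ((tangentMatrix d).mulVec z) := by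
  rw [← Matrix.mulVec_mulVec, ← Matrix.mulVec_mulVec, Matrix.dotProduct_mulVec,
    Matrix.vecMul_transpose]

/-! ### Log-likelihoods with a nondegenerate interior maximum -/

/-- The log-likelihood relative to its value at `θ'`. -/
noncomputable def relLogLik {K V : ℕ} (w : Fin V → ℝ) (φ : Fin K → Fin V → ℝ) (θ' θ : Fin K → ℝ) :
    ℝ :=
  logLik w φ θ - logLik w φ θ'

/-- The log-likelihood with weights `w` and topics `φ` is stationary at `θ'` on the simplex, and
no direction tangent to the simplex leaves all word probabilities unchanged. -/
structure IsRegular {K V : ℕ} (w : Fin V → ℝ) (φ : Fin K → Fin V → ℝ) (θ' : Fin K → ℝ) : Prop where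
  weight_nonneg : ∀ v, 0 ≤ w v
  topic_nonneg : ∀ k v, 0 ≤ φ k v
  word_pos : ∀ v, 0 < w v → 0 < ∑ k, θ' k * φ k v
  score : ∀ k, ∑ v, w v * (φ k v / ∑ j, θ' j * φ j v) = 1
  inj : ∀ u : Fin K → ℝ, ∑ k, u k = 0 → (∀ v, 0 < w v → ∑ k, u k * φ k v = 0) → u = 0

/-- A word with positive probability under some mixture has positive probability under every
mixture with positive coefficients. -/
theorem word_pos_of_pos {K : ℕ} {φ : Fin K → ℝ} (hφ : ∀ k, 0 ≤ φ k) {θ' θ : Fin K → ℝ}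
    (h : 0 < ∑ k, θ' k * φ k) (hθ : ∀ k, 0 < θ k) : 0 < ∑ k, θ k * φ k := by
  obtain ⟨k, hk⟩ : ∃ k, φ k ≠ 0 := by
    by_contra! h0
    simp [h0] at h
  exact Finset.sum_pos' (fun j _ => mul_nonneg (hθ j).le (hφ j))
    ⟨k, Finset.mem_univ k, mul_pos (hθ k) ((hφ k).lt_of_ne' hk)⟩

theorem measurable_logLik {K V : ℕ} (w : Fin V → ℝ) (φ : Fin K → Fin V → ℝ) :
    Measurable (logLik w φ) := by
  unfold logLik
  fun_prop

theorem measurable_relLogLik {K V : ℕ} (w : Fin V → ℝ) (φ : Fin K → Fin V → ℝ) (θ' : Fin K → ℝ) :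
    Measurable (relLogLik w φ θ') :=
  (measurable_logLik w φ).sub_const _

/-- The relative change of the probability of the word `v` along a direction in the coordinates
`y` of the simplex. -/
noncomputable def wordForm {d V : ℕ} (φ : Fin (d + 1) → Fin V → ℝ) (θ' : Fin (d + 1) → ℝ)
    (v : Fin V) : (Fin d → ℝ) →ₗ[ℝ] ℝ :=
  (∑ k, (φ k v / ∑ j, θ' j * φ j v) • LinearMap.proj (R := ℝ) (φ := fun _ => ℝ) k) ∘ₗ
    (tangentMatrix d).mulVecLin

theorem wordForm_apply {d V : ℕ} (φ : Fin (d + 1) → Fin V → ℝ) (θ' : Fin (d + 1) → ℝ)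
    (v : Fin V) (x : Fin d → ℝ) :
    wordForm φ θ' v x
      = (∑ k, (tangentMatrix d).mulVec x k * φ k v) / ∑ j, θ' j * φ j v := by
  simp only [wordForm, LinearMap.comp_apply, LinearMap.sum_apply, LinearMap.smul_apply,
    LinearMap.proj_apply, Matrix.mulVecLin_apply, smul_eq_mul, Finset.sum_div]
  exact Finset.sum_congr rfl fun k _ => by ring

namespace IsRegular

section

variable {d V : ℕ} {w : Fin V → ℝ} {φ : Fin (d + 1) → Fin V → ℝ} {θ' : Fin (d + 1) → ℝ}

/-- The score is the same for every topic, and a tangent vector has coordinate sum zero. -/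
theorem sum_mul_wordForm (h : IsRegular w φ θ') (x : Fin d → ℝ) :
    ∑ v, w v * wordForm φ θ' v x = 0 := by
  have h1 : ∀ v, w v * wordForm φ θ' v x
      = ∑ k, (tangentMatrix d).mulVec x k * (w v * (φ k v / ∑ j, θ' j * φ j v)) := by
    intro v
    rw [wordForm_apply, Finset.sum_div, Finset.mul_sum]
    exact Finset.sum_congr rfl fun k _ => by ring
  simp only [h1]
  rw [Finset.sum_comm]
  simp only [← Finset.mul_sum, h.score, mul_one, sum_tangentMatrix_mulVec]

theorem eq_zero_of_wordForm (h : IsRegular w φ θ') {x : Fin d → ℝ}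
    (hx : ∀ v, 0 < w v → wordForm φ θ' v x = 0) : x = 0 := by
  refine eq_zero_of_tangentMatrix_mulVec_eq_zero (h.inj _ (sum_tangentMatrix_mulVec x) ?_)
  intro v hv
  have := hx v hv
  rw [wordForm_apply, div_eq_zero_iff] at this
  exact this.resolve_right (h.word_pos v hv).ne'

theorem one_add_wordForm (h : IsRegular w φ θ') {y₀ : Fin d → ℝ} (hy₀ : simplexMap d y₀ = θ')
    (y : Fin d → ℝ) {v : Fin V} (hv : 0 < w v) :
    1 + wordForm φ θ' v (y - y₀)
      = (∑ k, simplexMap d y k * φ k v) / ∑ k, θ' k * φ k v := by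
  have h0 := (h.word_pos v hv).ne'
  rw [wordForm_apply, simplexMap_eq_add y y₀, hy₀]
  simp only [Pi.add_apply, add_mul, Finset.sum_add_distrib]
  rw [add_div, div_self h0]

theorem one_add_wordForm_pos (h : IsRegular w φ θ') {y₀ : Fin d → ℝ} (hy₀ : simplexMap d y₀ = θ')
    {y : Fin d → ℝ} (hy : y ∈ posSimplex d) {v : Fin V} (hv : 0 < w v) :
    0 < 1 + wordForm φ θ' v (y - y₀) := by
  rw [h.one_add_wordForm hy₀ y hv]
  exact div_pos (word_pos_of_pos (fun k => h.topic_nonneg k v) (h.word_pos v hv) hy)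
    (h.word_pos v hv)

theorem relLogLik_simplexMap (h : IsRegular w φ θ') {y₀ : Fin d → ℝ}
    (hy₀ : simplexMap d y₀ = θ') {y : Fin d → ℝ} (hy : y ∈ posSimplex d) :
    relLogLik w φ θ' (simplexMap d y)
      = ∑ v, w v * Real.log (1 + wordForm φ θ' v (y - y₀)) := by
  rw [relLogLik, logLik, logLik, ← Finset.sum_sub_distrib]
  refine Finset.sum_congr rfl fun v _ => ?_
  rcases (h.weight_nonneg v).eq_or_lt with hv | hv
  · simp [← hv]
  · rw [h.one_add_wordForm hy₀ y hv, Real.log_div _ (h.word_pos v hv).ne', mul_sub]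
    exact (word_pos_of_pos (fun k => h.topic_nonneg k v) (h.word_pos v hv) hy).ne'

/-- Apply `log(1+t) ≤ t` to each word; the linear terms cancel. -/
theorem relLogLik_simplexMap_nonpos (h : IsRegular w φ θ') {y₀ : Fin d → ℝ}
    (hy₀ : simplexMap d y₀ = θ') {y : Fin d → ℝ} (hy : y ∈ posSimplex d) :
    relLogLik w φ θ' (simplexMap d y) ≤ 0 := by
  rw [h.relLogLik_simplexMap hy₀ hy, ← h.sum_mul_wordForm (y - y₀)]
  refine Finset.sum_le_sum fun v _ => ?_
  rcases (h.weight_nonneg v).eq_or_lt with hv | hv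
  · simp [← hv]
  · have := Real.log_le_sub_one_of_pos (h.one_add_wordForm_pos hy₀ hy hv)
    exact mul_le_mul_of_nonneg_left (by linarith) hv.le

/-- Pairing with `θ'` cancels one of the two denominators and leaves the score, which is 1. -/
theorem fisherMatrix_mulVec (h : IsRegular w φ θ') : (fisherMatrix w φ θ').mulVec θ' = 1 := by
  funext i
  rw [Pi.one_apply, ← h.score i]
  simp only [Matrix.mulVec, dotProduct, fisherMatrix, Matrix.of_apply, Finset.sum_mul]
  rw [Finset.sum_comm]
  refine Finset.sum_congr rfl fun v _ => ?_
  rcases (h.weight_nonneg v).eq_or_lt with hv | hv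
  · simp [← hv]
  · have h0 := (h.word_pos v hv).ne'
    have h1 : ∀ j, w v * (φ i v * φ j v / (∑ k, θ' k * φ k v) ^ 2) * θ' j
        = w v * φ i v / (∑ k, θ' k * φ k v) ^ 2 * (θ' j * φ j v) := fun j => by ring
    simp only [h1, ← Finset.mul_sum]
    field_simp

theorem dotProduct_compression_mulVec (z : Fin d → ℝ) :
    z ⬝ᵥ ((tangentMatrix d).transpose * fisherMatrix w φ θ' * tangentMatrix d).mulVec z
      = ∑ v, w v * wordForm φ θ' v z ^ 2 := by
  simp only [LDA.dotProduct_compression_mulVec, dotProduct_fisherMatrix_mulVec, wordForm_apply]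

/-- The form is `∑ w_v ℓ_v(z)²`, which by `inj` vanishes only at `z = 0`. -/
theorem posDef_compression (h : IsRegular w φ θ') :
    ((tangentMatrix d).transpose * fisherMatrix w φ θ' * tangentMatrix d).PosDef := by
  refine Matrix.posDef_iff_dotProduct_mulVec.2 ⟨?_, fun z hz => ?_⟩
  · rw [Matrix.isHermitian_iff_isSymm]
    have := fisherMatrix_isSymm w φ θ'
    rw [Matrix.IsSymm] at this ⊢
    rw [Matrix.transpose_mul, Matrix.transpose_mul, this, Matrix.transpose_transpose,
      Matrix.mul_assoc]
  · rw [star_trivial, dotProduct_compression_mulVec]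
    have hnn : ∀ v ∈ Finset.univ, 0 ≤ w v * wordForm φ θ' v z ^ 2 :=
      fun v _ => mul_nonneg (h.weight_nonneg v) (sq_nonneg _)
    refine (Finset.sum_nonneg hnn).lt_of_ne' fun h0 => hz (h.eq_zero_of_wordForm fun v hv => ?_)
    have := (Finset.sum_eq_zero_iff_of_nonneg hnn).1 h0 v (Finset.mem_univ v)
    simpa [hv.ne'] using this

end

/-- The leading coefficient, apart from the determinant, in `tendsto_integral_exp`. -/
noncomputable def laplaceConst {d : ℕ} (α : Fin (d + 1) → ℝ) (θ' : Fin (d + 1) → ℝ) : ℝ :=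
  dirichletDensity α (fun i => θ' i.castSucc) * (gaussianMass d / √(2 ^ d))

variable {d V₁ V₂ : ℕ} {w₁ : Fin V₁ → ℝ} {φ₁ : Fin (d + 1) → Fin V₁ → ℝ} {w₂ : Fin V₂ → ℝ}
  {φ₂ : Fin (d + 1) → Fin V₂ → ℝ} {θ' : Fin (d + 1) → ℝ}

/-- The average, unlike the sum, maps `θ'` to the all-ones vector, so the compression lemma applies
to it. The factor `2^d` comes from the `d × d` compressed determinant. -/
theorem det_half_add (h₁ : IsRegular w₁ φ₁ θ') (h₂ : IsRegular w₂ φ₂ θ') (hθ' : ∑ k, θ' k = 1) :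
    0 < ((1 / 2 : ℝ) • (fisherMatrix w₁ φ₁ θ' + fisherMatrix w₂ φ₂ θ')).det ∧
    ((tangentMatrix d).transpose * fisherMatrix w₁ φ₁ θ' * tangentMatrix d +
      (tangentMatrix d).transpose * fisherMatrix w₂ φ₂ θ' * tangentMatrix d).det
      = 2 ^ d * ((1 / 2 : ℝ) • (fisherMatrix w₁ φ₁ θ' + fisherMatrix w₂ φ₂ θ')).det := by
  have hone : ((1 / 2 : ℝ) • (fisherMatrix w₁ φ₁ θ' + fisherMatrix w₂ φ₂ θ')).mulVec θ' = 1 := by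
    rw [Matrix.smul_mulVec, Matrix.add_mulVec, h₁.fisherMatrix_mulVec, h₂.fisherMatrix_mulVec]
    funext i
    simp
    norm_num
  have hpos := (h₁.posDef_compression.add h₂.posDef_compression).det_pos
  have e : ((tangentMatrix d).transpose * fisherMatrix w₁ φ₁ θ' * tangentMatrix d +
      (tangentMatrix d).transpose * fisherMatrix w₂ φ₂ θ' * tangentMatrix d).det
      = 2 ^ d * ((1 / 2 : ℝ) • (fisherMatrix w₁ φ₁ θ' + fisherMatrix w₂ φ₂ θ')).det := by
    rw [← det_tangentMatrix_compression hone hθ', ← Matrix.add_mul, ← Matrix.mul_add,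
      Matrix.mul_smul, Matrix.smul_mul, Matrix.det_smul, Fintype.card_fin, ← mul_assoc, ← mul_pow]
    norm_num
  refine ⟨?_, e⟩
  rw [e] at hpos
  exact pos_of_mul_pos_right hpos (by positivity)

/-- Laplace asymptotics of `∫ e^{n (F₁ + F₂)}` under the Dirichlet distribution. -/
theorem tendsto_integral_exp (hd : 1 ≤ d) {α : Fin (d + 1) → ℝ} (hα : ∀ k, 0 < α k)
    (h₁ : IsRegular w₁ φ₁ θ') (h₂ : IsRegular w₂ φ₂ θ') (hθ' : ∑ k, θ' k = 1)
    (hpos : ∀ k, 0 < θ' k) :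
    Tendsto (fun n : ℝ => √n ^ d * ∫ θ, Real.exp (n * (relLogLik w₁ φ₁ θ' θ
        + relLogLik w₂ φ₂ θ' θ)) ∂dirichlet α) atTop
      (𝓝 (laplaceConst α θ'
        / √((1 / 2 : ℝ) • (fisherMatrix w₁ φ₁ θ' + fisherMatrix w₂ φ₂ θ')).det)) := by
  set y₀ : Fin d → ℝ := fun i => θ' i.castSucc with hy₀def
  have hy₀ : simplexMap d y₀ = θ' := simplexMap_init hθ'
  have hy₀S : y₀ ∈ posSimplex d := fun k => by rw [hy₀]; exact hpos k
  -- The sum of the two functions is one mixture of logarithms over the disjoint union of the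
  -- vocabularies.
  have key := tendsto_laplace_log (ι := Fin V₁ ⊕ Fin V₂) (isOpen_posSimplex d).measurableSet
    (isBounded_posSimplex d) ((isOpen_posSimplex d).mem_nhds hy₀S) (measurable_dirichletDensity α)
    (integrableOn_dirichletDensity hα) (continuousAt_dirichletDensity α hy₀S)
    (w := Sum.elim w₁ w₂) (l := Sum.elim (wordForm φ₁ θ') (wordForm φ₂ θ'))
    (by rintro (v | v); exacts [h₁.weight_nonneg v, h₂.weight_nonneg v])
    (by
      rintro y hy (v | v) hv
      exacts [h₁.one_add_wordForm_pos hy₀ hy hv, h₂.one_add_wordForm_pos hy₀ hy hv])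
    (fun x => by simp [h₁.sum_mul_wordForm, h₂.sum_mul_wordForm])
    (fun x hx => h₁.eq_zero_of_wordForm fun v hv => hx (Sum.inl v) hv)
  have hlim : dirichletDensity α y₀ * ∫ z : Fin d → ℝ, Real.exp (-((∑ v, Sum.elim w₁ w₂ v *
      Sum.elim (wordForm φ₁ θ') (wordForm φ₂ θ') v z ^ 2) / 2))
      = laplaceConst α θ'
        / √((1 / 2 : ℝ) • (fisherMatrix w₁ φ₁ θ' + fisherMatrix w₂ φ₂ θ')).det := by
    have hg := integral_exp_neg_quadratic (h₁.posDef_compression.add h₂.posDef_compression)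
    simp only [Matrix.add_mulVec, dotProduct_add, dotProduct_compression_mulVec] at hg
    simp only [Fintype.sum_sum_type, Sum.elim_inl, Sum.elim_inr]
    rw [hg, (h₁.det_half_add h₂ hθ').2, Real.sqrt_mul (by positivity), laplaceConst,
      ← div_div, mul_div_assoc]
  rw [hlim] at key
  refine key.congr fun n => ?_
  congr 1
  rw [integral_dirichlet hd hα (F := fun θ => Real.exp (n * (relLogLik w₁ φ₁ θ' θ
        + relLogLik w₂ φ₂ θ' θ))) (by
      have := measurable_relLogLik w₁ φ₁ θ'
      have := measurable_relLogLik w₂ φ₂ θ'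
      fun_prop)]
  refine setIntegral_congr_fun (isOpen_posSimplex d).measurableSet fun y hy => ?_
  simp only [Fintype.sum_sum_type, Sum.elim_inl, Sum.elim_inr]
  rw [h₁.relLogLik_simplexMap hy₀ hy, h₂.relLogLik_simplexMap hy₀ hy]

/-- Use `nF = (n/2)(F + F)`. Only the order of magnitude matters, so the limit stays unnamed. -/
theorem tendsto_integral_exp_single (hd : 1 ≤ d) {α : Fin (d + 1) → ℝ} (hα : ∀ k, 0 < α k)
    (h₁ : IsRegular w₁ φ₁ θ') (hθ' : ∑ k, θ' k = 1) (hpos : ∀ k, 0 < θ' k) :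
    ∃ L, Tendsto (fun n : ℝ => √n ^ d * ∫ θ, Real.exp (n * relLogLik w₁ φ₁ θ' θ) ∂dirichlet α)
      atTop (𝓝 L) := by
  have h := ((h₁.tendsto_integral_exp hd hα h₁ hθ' hpos).comp
    (tendsto_id.atTop_div_const (two_pos : (0 : ℝ) < 2))).const_mul (√2 ^ d)
  refine ⟨_, h.congr fun n => ?_⟩
  simp only [Function.comp_apply, id]
  rw [← mul_assoc, ← mul_pow, ← Real.sqrt_mul zero_le_two, mul_div_cancel₀ _ two_ne_zero]
  congr 1
  refine integral_congr_ae (ae_of_all _ fun θ => ?_)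
  simp only
  congr 1
  ring

end IsRegular

/-! ### Covariances -/

/-- If the exponential moments of `F + G`, `F` and `G` all have order `n ^ (-d / 2)`, then the
covariance of `e^{n F}` and `e^{n G}` is asymptotic to the moment of `F + G`. -/
theorem tendsto_covariance_exp {Ω : Type*} [MeasurableSpace Ω] {μ : Measure Ω} [IsFiniteMeasure μ]
    {F G : Ω → ℝ} (hF : Measurable F) (hG : Measurable G) (hF0 : ∀ᵐ x ∂μ, F x ≤ 0)
    (hG0 : ∀ᵐ x ∂μ, G x ≤ 0) {d : ℕ} (hd : 1 ≤ d) {L LF LG : ℝ}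
    (hL : Tendsto (fun n : ℝ => √n ^ d * ∫ x, Real.exp (n * (F x + G x)) ∂μ) atTop (𝓝 L))
    (hLF : Tendsto (fun n : ℝ => √n ^ d * ∫ x, Real.exp (n * F x) ∂μ) atTop (𝓝 LF))
    (hLG : Tendsto (fun n : ℝ => √n ^ d * ∫ x, Real.exp (n * G x) ∂μ) atTop (𝓝 LG)) :
    Tendsto (fun n : ℝ => √n ^ d *
      covariance (fun x => Real.exp (n * F x)) (fun x => Real.exp (n * G x)) μ) atTop (𝓝 L) := by
  have hint : ∀ {H : Ω → ℝ}, Measurable H → (∀ᵐ x ∂μ, H x ≤ 0) → ∀ n : ℝ, 0 ≤ n →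
      Integrable (fun x => Real.exp (n * H x)) μ := by
    intro H hH hH0 n hn
    refine Integrable.of_bound (by fun_prop) 1 ?_
    filter_upwards [hH0] with x hx
    rw [Real.norm_of_nonneg (Real.exp_pos _).le]
    exact Real.exp_le_one_iff.2 (mul_nonpos_of_nonneg_of_nonpos hn hx)
  have hinv : Tendsto (fun n : ℝ => (√n ^ d)⁻¹) atTop (𝓝 0) :=
    tendsto_inv_atTop_zero.comp ((tendsto_pow_atTop (by omega)).comp Real.tendsto_sqrt_atTop)
  -- For total mass `m`, expanding the centred product gives the coefficient `m - 2` of the product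
  -- of the means, which is `-1` for a probability measure.
  have h := hL.add (((hLF.mul hLG).mul hinv).mul_const (μ.real Set.univ - 2))
  rw [mul_zero, zero_mul, add_zero] at h
  refine h.congr' ?_
  filter_upwards [eventually_gt_atTop 0] with n hn
  have hs : √n ^ d ≠ 0 := (pow_pos (Real.sqrt_pos.2 hn) d).ne'
  have iF := hint hF hF0 n hn.le
  have iG := hint hG hG0 n hn.le
  have iFG := hint (hF.add hG) (by filter_upwards [hF0, hG0] with x h1 h2 using add_nonpos h1 h2)
    n hn.le
  simp only [Pi.add_apply] at iFG
  set a := ∫ x, Real.exp (n * F x) ∂μ with ha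
  set b := ∫ x, Real.exp (n * G x) ∂μ with hb
  have hcov : covariance (fun x => Real.exp (n * F x)) (fun x => Real.exp (n * G x)) μ
      = ∫ x, Real.exp (n * (F x + G x)) ∂μ + a * b * (μ.real Set.univ - 2) := by
    have e : ∀ x, (Real.exp (n * F x) - a) * (Real.exp (n * G x) - b)
        = Real.exp (n * (F x + G x)) - Real.exp (n * F x) * b - a * Real.exp (n * G x)
          + a * b := by
      intro x
      rw [mul_add, Real.exp_add]
      ring
    rw [covariance]
    simp only [← ha, ← hb, e]
    have i1 : Integrable (fun x => Real.exp (n * (F x + G x)) - Real.exp (n * F x) * b) μ :=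
      iFG.sub (iF.mul_const b)
    have i2 : Integrable (fun x => Real.exp (n * (F x + G x)) - Real.exp (n * F x) * b
        - a * Real.exp (n * G x)) μ := i1.sub (iG.const_mul a)
    rw [integral_add i2 (integrable_const _), integral_sub i1 (iG.const_mul a),
      integral_sub iFG (iF.mul_const b), integral_mul_const, integral_const_mul, integral_const,
      ← ha, ← hb, smul_eq_mul]
    ring
  rw [hcov]
  field_simp

/-- Serves to strip the common factor `e^{nH(θ*)}`. -/
theorem covariance_congr_const_mul {Ω : Type*} [MeasurableSpace Ω] {μ : Measure Ω}
    {X Y X' Y' : Ω → ℝ} {c : ℝ} (hX : ∀ᵐ x ∂μ, X x = c * X' x) (hY : ∀ᵐ x ∂μ, Y x = c * Y' x) :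
    covariance X Y μ = c ^ 2 * covariance X' Y' μ := by
  rw [covariance, covariance, integral_congr_ae hX, integral_congr_ae hY, integral_const_mul,
    integral_const_mul, ← integral_const_mul (c ^ 2)]
  refine integral_congr_ae ?_
  filter_upwards [hX, hY] with x h1 h2
  rw [h1, h2]
  ring

theorem correlation_sq {Ω : Type*} [MeasurableSpace Ω] {μ : Measure Ω} {X Y : Ω → ℝ}
    (hX : AEMeasurable X μ) (hY : AEMeasurable Y μ) :
    correlation X Y μ ^ 2
      = covariance X Y μ ^ 2 / (covariance X X μ * covariance Y Y μ) := by
  rw [correlation, div_pow, Real.sq_sqrt (mul_nonneg (variance_nonneg _ _) (variance_nonneg _ _)),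
    covariance_self hX, covariance_self hY]

/-! ### The two log-likelihoods -/

theorem isRegular_single {K : ℕ} {θ' : Fin K → ℝ} (hpos : ∀ k, 0 < θ' k) :
    IsRegular θ' (fun k => Pi.single k 1) θ' where
  weight_nonneg k := (hpos k).le
  topic_nonneg k v := by
    rw [Pi.single_apply]
    split_ifs <;> norm_num
  word_pos v _ := by
    rw [sum_mul_single]
    exact hpos v
  score k := by
    simp only [sum_mul_single]
    rw [Finset.sum_eq_single k]
    · rw [Pi.single_eq_same, mul_one_div_cancel (hpos k).ne']
    · intro v _ hv
      rw [Pi.single_eq_of_ne hv]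
      simp
    · simp
  inj u _ hu := by
    funext v
    have := hu v (hpos v)
    rwa [sum_mul_single] at this

/-- Interiority gives stationarity in every tangent direction; uniqueness gives `inj`. -/
theorem IsUniqueMaximizer.isRegular {K V : ℕ} {p : Fin V → ℝ} (hp : p ∈ stdSimplex ℝ (Fin V))
    {φ : Fin K → Fin V → ℝ} (hφ : ∀ k, φ k ∈ stdSimplex ℝ (Fin V)) {θ' : Fin K → ℝ}
    (hmax : IsUniqueMaximizer p φ θ') (hpos : ∀ k, 0 < θ' k) : IsRegular p φ θ' := by
  have hword := hmax.1.2
  -- a neighbourhood of `θ'` in every tangent direction lies in the domain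
  have hdom : ∀ u : Fin K → ℝ, ∑ k, u k = 0 → ∀ᶠ t : ℝ in 𝓝 0, θ' + t • u ∈ finiteDomain p φ := by
    intro u hu
    have h1 : ∀ᶠ t : ℝ in 𝓝 0, ∀ k, 0 < (θ' + t • u) k := by
      refine eventually_all.2 fun k => ?_
      have hc : ContinuousAt (fun t : ℝ => (θ' + t • u) k) 0 := by
        simp only [Pi.add_apply, Pi.smul_apply, smul_eq_mul]
        fun_prop
      exact hc.eventually_const_lt (by simpa using hpos k)
    filter_upwards [h1] with t ht
    refine ⟨⟨fun k => (ht k).le, ?_⟩, fun v hv => ?_⟩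
    · simp [Finset.sum_add_distrib, ← Finset.mul_sum, hu, hmax.1.1.2]
    · exact word_pos_of_pos (fun k => (hφ k).1 v) (hword v hv) ht
  have hline : ∀ (u : Fin K → ℝ) (t : ℝ) v, ∑ k, (θ' + t • u) k * φ k v
      = ∑ k, θ' k * φ k v + t * ∑ k, u k * φ k v := by
    intro u t v
    simp only [Pi.add_apply, Pi.smul_apply, smul_eq_mul, add_mul, Finset.sum_add_distrib,
      Finset.mul_sum, mul_assoc]
  -- stationarity along the simplex
  have hstat : ∀ u : Fin K → ℝ, ∑ k, u k = 0 →
      ∑ v, p v * ((∑ k, u k * φ k v) / ∑ k, θ' k * φ k v) = 0 := by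
    intro u hu
    have hder : HasDerivAt (fun t : ℝ => logLik p φ (θ' + t • u))
        (∑ v, p v * ((∑ k, u k * φ k v) / ∑ k, θ' k * φ k v)) 0 := by
      simp only [logLik, hline]
      refine HasDerivAt.fun_sum fun v _ => ?_
      rcases (hp.1 v).eq_or_lt with hv | hv
      · simpa [← hv] using hasDerivAt_const (0 : ℝ) (0 : ℝ)
      · have h1 : HasDerivAt (fun t : ℝ => ∑ k, θ' k * φ k v + t * ∑ k, u k * φ k v)
            (∑ k, u k * φ k v) 0 := by
          simpa using ((hasDerivAt_id (0 : ℝ)).mul_const (∑ k, u k * φ k v)).const_add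
            (∑ k, θ' k * φ k v)
        have h2 := (h1.log (by simpa using (hword v hv).ne')).const_mul (p v)
        simpa using h2
    refine IsLocalMax.hasDerivAt_eq_zero ?_ hder
    filter_upwards [hdom u hu] with t ht
    rw [zero_smul, add_zero]
    rcases eq_or_ne (θ' + t • u) θ' with h | h
    · rw [h]
    · exact (hmax.2 _ ht h).le
  refine ⟨hp.1, fun k v => (hφ k).1 v, hword, fun k => ?_, fun u hu hzero => ?_⟩
  -- In the direction from `θ'` to vertex `k` the derivative is the score of `k` minus `∑ p_v = 1`.
  · have h1 := hstat (Pi.single k 1 - θ') (by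
      rw [← hmax.1.1.2]
      simp [hmax.1.1.2])
    have h2 : ∀ v, p v * ((∑ j, (Pi.single k 1 - θ' : Fin K → ℝ) j * φ j v) / ∑ j, θ' j * φ j v)
        = p v * (φ k v / ∑ j, θ' j * φ j v) - p v := by
      intro v
      have h3 : ∑ j, (Pi.single k 1 - θ' : Fin K → ℝ) j * φ j v = φ k v - ∑ j, θ' j * φ j v := by
        simp [sub_mul, Pi.single_apply]
      rcases (hp.1 v).eq_or_lt with hv | hv
      · simp [← hv]
      · have h0 := (hword v hv).ne'
        rw [h3, sub_div, div_self h0]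
        ring
    simp only [h2, Finset.sum_sub_distrib, hp.2] at h1
    linarith
  -- Moving along a nonzero `u` that fixes all word probabilities would reach a second maximizer.
  · by_contra hu0
    have hne : ∀ᶠ t : ℝ in 𝓝[≠] 0, θ' + t • u ∈ finiteDomain p φ ∧ t ≠ 0 :=
      ((hdom u hu).filter_mono nhdsWithin_le_nhds).and self_mem_nhdsWithin
    obtain ⟨t, ht, ht0⟩ := hne.exists
    have hlt := hmax.2 _ ht (by simp [ht0, hu0])
    refine hlt.ne ?_
    simp only [logLik, hline]
    refine Finset.sum_congr rfl fun v _ => ?_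
    rcases (hp.1 v).eq_or_lt with hv | hv
    · simp [← hv]
    · rw [hzero v hv, mul_zero, add_zero]

end LDA

/-! ### The limit of the squared correlation -/

theorem mainTheorem7 (d V : ℕ) (hd : 1 ≤ d)
    (α : Fin (d + 1) → ℝ) (hα : ∀ k, 0 < α k)
    (p : Fin V → ℝ) (hp : p ∈ stdSimplex ℝ (Fin V))
    (φ : Fin (d + 1) → Fin V → ℝ) (hφ : ∀ k, φ k ∈ stdSimplex ℝ (Fin V))
    (θ' : Fin (d + 1) → ℝ) (hmax : LDA.IsUniqueMaximizer p φ θ')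
    (hint : ∀ k, 0 < θ' k)
    (Q R : Matrix (Fin (d + 1)) (Fin (d + 1)) ℝ)
    (hQ : Q = LDA.hessian (LDA.logLik p φ) θ')
    (hR : R = -LDA.hessian (LDA.klDivergence θ') θ') :
    Tendsto (fun n : ℝ => LDA.cvCorrelation α p φ θ' n ^ 2) atTop
      (𝓝 (|Q.det| ^ (1 / 2 : ℝ) * |R.det| ^ (1 / 2 : ℝ) / |((1 / 2 : ℝ) • (Q + R)).det|)) := by
  open LDA in
  have hsum : ∑ k, θ' k = 1 := hmax.1.1.2
  have h₁ : IsRegular p φ θ' := hmax.isRegular hp hφ hint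
  have h₂ : IsRegular θ' (fun k => Pi.single k 1) θ' := isRegular_single hint
  set A := fisherMatrix p φ θ' with hA
  set B := fisherMatrix θ' (fun k => Pi.single k 1) θ' with hB
  have hQA : Q = -A := by
    refine hQ.trans (hessian_logLik fun v hv => (h₁.word_pos v ?_).ne')
    exact (h₁.weight_nonneg v).lt_of_ne' hv
  have hRB : R = -B := by rw [hR, hessian_klDivergence hint]
  have := isFiniteMeasure_dirichlet hd hα
  set μ := dirichlet α with hμ
  set F := relLogLik p φ θ' with hF
  set G := relLogLik θ' (fun k => Pi.single k 1) θ' with hG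
  have hFm : Measurable F := measurable_relLogLik _ _ _
  have hGm : Measurable G := measurable_relLogLik _ _ _
  have hF0 : ∀ᵐ θ ∂μ, F θ ≤ 0 := ae_dirichlet_of_posSimplex hd α
    (measurableSet_le hFm measurable_const) fun y hy =>
      h₁.relLogLik_simplexMap_nonpos (simplexMap_init hsum) hy
  have hG0 : ∀ᵐ θ ∂μ, G θ ≤ 0 := ae_dirichlet_of_posSimplex hd α
    (measurableSet_le hGm measurable_const) fun y hy =>
      h₂.relLogLik_simplexMap_nonpos (simplexMap_init hsum) hy
  -- the asymptotics of the covariances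
  obtain ⟨LF, hLF⟩ := h₁.tendsto_integral_exp_single hd hα hsum hint
  obtain ⟨LG, hLG⟩ := h₂.tendsto_integral_exp_single hd hα hsum hint
  have cFG := tendsto_covariance_exp hFm hGm hF0 hG0 hd
    (h₁.tendsto_integral_exp hd hα h₂ hsum hint) hLF hLG
  have cFF := tendsto_covariance_exp hFm hFm hF0 hF0 hd
    (h₁.tendsto_integral_exp hd hα h₁ hsum hint) hLF hLF
  have cGG := tendsto_covariance_exp hGm hGm hG0 hG0 hd
    (h₂.tendsto_integral_exp hd hα h₂ hsum hint) hLG hLG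
  have dFG := (h₁.det_half_add h₂ hsum).1
  have dFF := (h₁.det_half_add h₁ hsum).1
  have dGG := (h₂.det_half_add h₂ hsum).1
  have hhalf : ∀ M : Matrix (Fin (d + 1)) (Fin (d + 1)) ℝ, (1 / 2 : ℝ) • (M + M) = M := by
    intro M
    rw [← two_smul ℝ M, smul_smul]
    norm_num
  rw [← hA, hhalf] at dFF cFF
  rw [← hB, hhalf] at dGG cGG
  rw [← hA, ← hB] at dFG cFG
  have hκ : 0 < IsRegular.laplaceConst α θ' := by
    refine mul_pos (dirichletDensity_pos hα fun k => ?_)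
      (div_pos (gaussianMass_pos d) (by positivity))
    rw [simplexMap_init hsum]
    exact hint k
  set κ := IsRegular.laplaceConst α θ'
  have hquot := (cFG.pow 2).div (cFF.mul cGG) (by positivity)
  have hval : (κ / √((1 / 2 : ℝ) • (A + B)).det) ^ 2 / (κ / √A.det * (κ / √B.det))
      = |Q.det| ^ (1 / 2 : ℝ) * |R.det| ^ (1 / 2 : ℝ) / |((1 / 2 : ℝ) • (Q + R)).det| := by
    -- `Q` and `R` are the negatives of `A` and `B`; the sign `(-1)^K` disappears under absolute
    -- values.
    have hneg : ∀ M : Matrix (Fin (d + 1)) (Fin (d + 1)) ℝ, |(-M).det| = |M.det| := by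
      intro M
      rw [Matrix.det_neg, abs_mul, abs_pow, abs_neg, abs_one, one_pow, one_mul]
    rw [hQA, hRB, ← neg_add, smul_neg, hneg, hneg, hneg, abs_of_pos dFF, abs_of_pos dGG,
      abs_of_pos dFG, ← Real.sqrt_eq_rpow, ← Real.sqrt_eq_rpow, div_pow, Real.sq_sqrt dFG.le]
    have := Real.sqrt_pos.2 dFF
    have := Real.sqrt_pos.2 dGG
    field_simp
  rw [← hval]
  refine hquot.congr' ?_
  filter_upwards [eventually_gt_atTop 0] with n hn
  have hs : √n ^ d ≠ 0 := (pow_pos (Real.sqrt_pos.2 hn) d).ne'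
  have eF : ∀ᵐ θ ∂μ, Real.exp (n * logLik p φ θ)
      = Real.exp (n * logLik p φ θ') * Real.exp (n * F θ) := by
    refine ae_of_all _ fun θ => ?_
    rw [← Real.exp_add, hF, relLogLik]
    congr 1
    ring
  have hCm : Measurable fun θ => Real.exp (n * controlExponent p φ θ' θ) := by
    unfold controlExponent klDivergence
    fun_prop
  have hHm : Measurable fun θ => Real.exp (n * logLik p φ θ) := by
    have := measurable_logLik p φ
    fun_prop
  have eG : ∀ᵐ θ ∂μ, Real.exp (n * controlExponent p φ θ' θ)
      = Real.exp (n * logLik p φ θ') * Real.exp (n * G θ) := by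
    -- Only almost everywhere: on the faces the default values of `log` and division break
    -- `klDivergence_eq`.
    refine ae_dirichlet_of_posSimplex hd α (measurableSet_eq_fun hCm (by fun_prop)) fun y hy => ?_
    rw [← Real.exp_add, hG, relLogLik, controlExponent, klDivergence_eq hint hy]
    congr 1
    ring
  rw [cvCorrelation, correlation_sq hHm.aemeasurable hCm.aemeasurable,
    covariance_congr_const_mul eF eG, covariance_congr_const_mul eF eF,
    covariance_congr_const_mul eG eG]
  have hscale : ∀ a x y z : ℝ, a ≠ 0 → (a * x) ^ 2 / (a * y * (a * z)) = x ^ 2 / (y * z) := by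
    intro a x y z ha
    rw [mul_pow, mul_mul_mul_comm, ← sq, mul_div_mul_left _ _ (pow_ne_zero 2 ha)]
  rw [Pi.div_apply, hscale _ _ _ _ hs, hscale _ _ _ _ (by positivity)]
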